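/- Let $\mathcal O$ be a commutative ring with $\operatorname{Spec}\mathcal O$ connected, and let $G$ be a generalised torus over $\mathcal O$, i.e. a smooth affine $\mathcal O$-group scheme such that the geometric fibres of the identity component $G^0$ are tori and $G/G^0$ is finite over $\mathcal O$. Assume that $G^0$ is split, $G^0=\mathfrak D(M):=\operatorname{Spec}\mathcal O[M]$ with $M$ its character lattice (free of finite rank), so that $G^0(A)=\operatorname{Hom}(M,A^\times)$ for every commutative $\mathcal O$-algebra $A$, and that $G/G^0=\underline\Delta$ is the constant group scheme of a finite group $\Delta$; let $\Pi:G\to\underline\Delta$ be the projection, and let $\Delta$ act on $M$ through the conjugation action of $G$ on $G^0$. Let $\Gamma_1$ be an abstract group, $\pi:\Gamma_1\twoheadrightarrow\Delta$ a surjective homomorphism with kernel $\Gamma_2$; $\Gamma_1$ acts on $M$ and on $\mathfrak D(M)(A)$ through $\pi$. A representation $\rho:\Gamma_1\to G(A)$ is admissible if $\Pi\circ\rho=\pi$; let $\mathrm{Rep}^{\Gamma_1}_{G,\pi}(A)$ be the set of these, on which $\mathfrak D(M)(A)=G^0(A)$ acts by conjugation. A $G$-pseudocharacter of $\Gamma_1$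 over $A$ is a sequence of $\mathcal O$-algebra maps $\Theta_n:\mathcal O[G^n]^{G^0}\to\mathrm{Map}(\Gamma_1^n,A)$ ($n\ge1$), with $G^0$ acting by simultaneous conjugation, such that $\Theta_n(f^\zeta)(\gamma_1,\dots,\gamma_n)=\Theta_m(f)(\gamma_{\zeta(1)},\dots,\gamma_{\zeta(m)})$ for all maps $\zeta:\{1,\dots,m\}\to\{1,\dots,n\}$, and $\Theta_{n+1}(\hat f)(\gamma_1,\dots,\gamma_{n+1})=\Theta_n(f)(\gamma_1,\dots,\gamma_{n-1},\gamma_n\gamma_{n+1})$, where $f^\zeta(g_1,\dots,g_n)=f(g_{\zeta(1)},\dots,g_{\zeta(m)})$ and $\hat f(g_1,\dots,g_{n+1})=f(g_1,\dots,g_{n-1},g_ng_{n+1})$. Every $\rho:\Gamma_1\to G(A)$ gives $\Theta_\rho$, $(\Theta_\rho)_n(f)(\gamma_1,\dots,\gamma_n)=f(\rho(\gamma_1),\dots,\rho(\gamma_n))$. Let $\mathrm{PC}^{\Gamma_1}_{G,\pi}(A)$ be the set of those $\Theta$ that are admissible, i.e. whose image under $\Pi$ is the $\underline\Delta$-pseudocharacter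 of $\pi$. Choose representatives $\bar c\in\Gamma_1$ of the elements $c\in\Delta=\Gamma_1/\Gamma_2$ with $\bar1=1$, let $\kappa(d,c)\in\Gamma_2^{\mathrm{ab}}$ be the class of $\bar d\,\bar c\,\overline{dc}^{-1}$, let $I_\Delta\subset\mathbb Z[\Delta]$ be the augmentation ideal, and let $\mathcal E$ be the group $\Gamma_2^{\mathrm{ab}}\oplus I_\Delta$ with the $\Delta$-action $d*(g,c-1)=(dgd^{-1}\cdot\kappa(d,c),\,dc-d)$. Put $\Phi_{\mathrm{nat}}(\gamma)(m)=[(\gamma\,\overline{\pi(\gamma)}^{-1},\,\pi(\gamma)-1)\otimes m]\in(\mathcal E\otimes M)_\Delta$ (coinvariants for the diagonal action), for $\gamma\in\Gamma_1$ and $m\in M$. Assume that there is an admissible representation $\rho_0\in\mathrm{Rep}^{\Gamma_1}_{G,\pi}(\mathcal O)$. Then: (1) For every commutative $\mathcal O$-algebra $A$ the map $\Phi\mapsto\Phi\rho_0$ is a bijection $Z^1(\Gamma_1,\mathfrak D(M)(A))\to\mathrm{Rep}^{\Gamma_1}_{G,\pi}(A)$, natural in $A$. It is $\mathfrak D(M)(A)$-equivariant,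 where $t\in\mathfrak D(M)(A)$ acts on cocycles by multiplication with the coboundary $\gamma\mapsto t\cdot({}^\gamma t)^{-1}$, and it induces a natural bijection between $H^1(\Gamma_1,\mathfrak D(M)(A))$ and the set of $\mathfrak D(M)(A)$-orbits in $\mathrm{Rep}^{\Gamma_1}_{G,\pi}(A)$. (2) $\mathrm{Rep}^{\Gamma_1}_{G,\pi}$ is represented by the group algebra $\mathcal O[(\mathcal E\otimes M)_\Delta]$; a point $\psi:\mathcal O[(\mathcal E\otimes M)_\Delta]\to A$ corresponds to $(\psi\circ\Phi_{\mathrm{nat}})\,\rho_0$. (3) There is a homomorphism $\varphi_{\mathrm{nat}}:H_1(\Gamma_1,M)\to(\mathcal E\otimes M)_\Delta$ sending the class of a cycle $\sum_i m_i[\gamma_i]$ (i.e. $\sum_i(\gamma_i^{-1}m_i-m_i)=0$) to $\sum_i\Phi_{\mathrm{nat}}(\gamma_i)(m_i)$. The map sending the orbit of $\Phi\rho_0$ to the homomorphism $H_1(\Gamma_1,M)\to A^\times$, $[\sum_i m_i[\gamma_i]]\mapsto\prod_i\Phi(\gamma_i)(m_i)$, is well defined and natural in $A$, and exhibits $\operatorname{Spec}\mathcal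 O[H_1(\Gamma_1,M)]$ as the fpqc sheafification $\mathrm{Rep}^{\Gamma_1}_{G,\pi}/\mathfrak D(M)$ of the presheaf $A\mapsto\mathrm{Rep}^{\Gamma_1}_{G,\pi}(A)/\mathfrak D(M)(A)$. This quotient is also the GIT quotient: $\varphi_{\mathrm{nat}}$ induces an isomorphism of $\mathcal O[H_1(\Gamma_1,M)]$ onto the algebra of invariants $\mathcal O[(\mathcal E\otimes M)_\Delta]^{G^0}=\mathcal O(\mathrm{Rep}^{\Gamma_1}_{G,\pi})^{G^0}$. (4) $\mathrm{PC}^{\Gamma_1}_{G,\pi}$ is represented by $\mathcal O[H_1(\Gamma_1,M)]$, in such a way that the map $\mathrm{Rep}^{\Gamma_1}_{G,\pi}\to\mathrm{PC}^{\Gamma_1}_{G,\pi}$, $\rho\mapsto\Theta_\rho$, corresponds to the algebra homomorphism $\mathcal O[H_1(\Gamma_1,M)]\to\mathcal O[(\mathcal E\otimes M)_\Delta]$ induced by $\varphi_{\mathrm{nat}}$. -/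

import Mathlib

open CategoryTheory TensorProduct WithConv

universe u

namespace GenTorus

noncomputable section

/-! ### Points of affine group schemes -/

section Points

variable (O : Type u) [CommRing O] (H : Type u) [CommRing H] [HopfAlgebra O H]

/-- The `A`-valued points of the affine group scheme `Spec H` over `O`.  This is a group under
convolution: the product, unit and inverse are induced by the comultiplication, counit and antipode
of `H`. -/
def Pt (A : Type u) [CommRing A] [Algebra O A] : Type u := WithConv (H →ₐ[O] A)

instance (A : Type u) [CommRing A] [Algebra O A] : Group (Pt O H A) where
  toMonoid := inferInstanceAs (Monoid (WithConv (H →ₐ[O] A)))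
  inv f := toConv (f.ofConv.comp (HopfAlgebra.antipodeAlgHom O H))
  inv_mul_cancel f := by
    have h0 := (AlgHom.antipode_id_cancel (R := O) (A := H))
    have h1 := AlgHom.comp_convMul_distrib f.ofConv
      (toConv (HopfAlgebra.antipodeAlgHom O H)) (toConv (AlgHom.id O H))
    rw [h0] at h1
    apply ofConv_injective
    refine h1.symm.trans ?_
    ext x
    change f.ofConv ((1 : WithConv (H →ₐ[O] H)) x) = (1 : WithConv (H →ₐ[O] A)) x
    simp [AlgHom.convOne_apply]

variable {O H}
variable {A B : Type u} [CommRing A] [Algebra O A] [CommRing B] [Algebra O B]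

variable (H) in
/-- The map `G(A) → G(B)` induced by a morphism of `O`-algebras `A → B`. -/
def Pt.map (f : A →ₐ[O] B) : Pt O H A →* Pt O H B where
  toFun x := toConv (f.comp x.ofConv)
  map_one' := by
    apply ofConv_injective
    ext x
    change f ((1 : WithConv (H →ₐ[O] A)) x) = (1 : WithConv (H →ₐ[O] B)) x
    simp [AlgHom.convOne_apply]
  map_mul' x y := by
    apply ofConv_injective
    exact AlgHom.comp_convMul_distrib f x y

/-- The map `G(A) → G'(A)` induced by a homomorphism of group schemes `G → G'`, the latter being
given by the bialgebra homomorphism `φ : O[G'] → O[G]`. -/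
def Pt.push {H' : Type u} [CommRing H'] [HopfAlgebra O H'] (φ : H' →ₐc[O] H) :
    Pt O H A →* Pt O H' A where
  toFun x := toConv (x.ofConv.comp (φ : H' →ₐ[O] H))
  map_one' := by
    apply ofConv_injective
    ext x
    change (1 : WithConv (H →ₐ[O] A)) (φ x) = (1 : WithConv (H' →ₐ[O] A)) x
    simp [AlgHom.convOne_apply]
  map_mul' x y := by
    apply ofConv_injective
    exact AlgHom.convMul_comp_bialgHom_distrib x y φ

/-- A point of `G` with values in a field `K`, as a point of the topological space underlying the
fibre `G_K = Spec (K ⊗ H)`. -/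
def fibrePt {K : Type u} [Field K] [Algebra O K] (x : Pt O H K) : PrimeSpectrum (K ⊗[O] H) :=
  ⟨RingHom.ker (Algebra.TensorProduct.lift (AlgHom.id O K) x.ofConv (fun _ _ => Commute.all _ _)),
    RingHom.ker_isPrime _⟩

variable (O H A) in
/-- `G⁰(A)` for the relative identity component `G⁰` of the group scheme `G = Spec H`: the points of
`G(A)` which, on every geometric fibre, lie in the connected component of the identity. -/
def identityComponent : Set (Pt O H A) :=
  {g | ∀ (K : Type u) [Field K] [IsAlgClosed K] [Algebra O K] (φ : A →ₐ[O] K),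
    fibrePt (Pt.map H φ g) ∈ connectedComponent (fibrePt (1 : Pt O H K))}

theorem push_mem_identityComponent {H' : Type u} [CommRing H'] [HopfAlgebra O H']
    (φ : H' →ₐc[O] H) {g : Pt O H A} (hg : g ∈ identityComponent O H A) :
    Pt.push φ g ∈ identityComponent O H' A := by
  intro K _ _ _ ψ
  let F : K ⊗[O] H' →ₐ[O] K ⊗[O] H := Algebra.TensorProduct.map (AlgHom.id O K) (φ : H' →ₐ[O] H)
  have hF : ∀ x : Pt O H K, PrimeSpectrum.comap F.toRingHom (fibrePt x) = fibrePt (Pt.push φ x) := by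
    intro x
    have hc : (Algebra.TensorProduct.lift (AlgHom.id O K) x.ofConv
        (fun _ _ => Commute.all _ _)).comp F = Algebra.TensorProduct.lift (AlgHom.id O K)
          (Pt.push φ x).ofConv (fun _ _ => Commute.all _ _) := by
      ext y
      · simp [F]
      · simp only [F, AlgHom.comp_apply, AlgHom.restrictScalars_apply,
          Algebra.TensorProduct.includeRight_apply, Algebra.TensorProduct.map_tmul,
          Algebra.TensorProduct.lift_tmul, map_one, one_mul]
        rfl
    apply PrimeSpectrum.ext
    ext y
    have := DFunLike.congr_fun hc y
    simp only [fibrePt, PrimeSpectrum.comap_asIdeal, Ideal.mem_comap, RingHom.mem_ker]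
    rw [← this]
    rfl
  have h1 := (PrimeSpectrum.continuous_comap F.toRingHom).image_connectedComponent_subset
    (fibrePt (1 : Pt O H K)) ⟨_, hg K ψ, rfl⟩
  rw [hF, hF, map_one] at h1
  exact h1

variable (O H) in
/-- The coordinate ring of `Gⁿ`. -/
abbrev CoordPow (n : ℕ) : Type u := ⨂[O] _ : Fin n, H

/-- Evaluation of functions on `Gⁿ` at an `n`-tuple of points of `G`. -/
def evalAt {n : ℕ} (g : Fin n → Pt O H A) : CoordPow O H n →ₐ[O] A :=
  PiTensorProduct.liftAlgHom
    ((MultilinearMap.mkPiAlgebra O (Fin n) A).compLinearMap fun i => (g i).ofConv.toLinearMap)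
    (by simp) (fun x y => by simp [Finset.prod_mul_distrib])

theorem evalAt_tprod {n : ℕ} (g : Fin n → Pt O H A) (x : Fin n → H) :
    evalAt g (PiTensorProduct.tprod O x) = ∏ i, (g i).ofConv (x i) :=
  (PiTensorProduct.lift.tprod x).trans (by simp)

variable (O H) in
/-- The `i`-th projection `Gⁿ → G`, as a point of `G` with values in the coordinate ring of `Gⁿ`. -/
def coordPt (n : ℕ) (i : Fin n) : Pt O H (CoordPow O H n) :=
  toConv (PiTensorProduct.singleAlgHom (R := O) (A := fun _ : Fin n => H) i)

theorem map_evalAt_coordPt {n : ℕ} (g : Fin n → Pt O H A) (i : Fin n) :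
    Pt.map H (evalAt g) (coordPt O H n i) = g i := by
  apply ofConv_injective
  ext x
  change evalAt g (PiTensorProduct.tprod O (MonoidHom.mulSingle (fun _ : Fin n => H) i x)) = _
  rw [evalAt_tprod]
  rw [Finset.prod_eq_single i]
  · simp
  · intro j _ hj
    simp [Pi.mulSingle_eq_of_ne hj]
  · simp

theorem algHom_comp_evalAt {n : ℕ} (f : A →ₐ[O] B) (g : Fin n → Pt O H A) :
    f.comp (evalAt g) = evalAt fun i => Pt.map H f (g i) := by
  apply AlgHom.toLinearMap_injective
  apply PiTensorProduct.ext
  ext x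
  change f (evalAt g (PiTensorProduct.tprod O x)) =
    evalAt (fun i => Pt.map H f (g i)) (PiTensorProduct.tprod O x)
  rw [evalAt_tprod, evalAt_tprod, map_prod]
  rfl

variable (O H) in
/-- The algebra `O[Gⁿ]^{G⁰}` of functions on `Gⁿ` which are invariant under simultaneous
conjugation by `G⁰`. -/
def invariants (n : ℕ) : Subalgebra O (CoordPow O H n) where
  carrier := {f | ∀ (A : Type u) [CommRing A] [Algebra O A], ∀ h ∈ identityComponent O H A,
    ∀ g : Fin n → Pt O H A, evalAt (fun i => h * g i * h⁻¹) f = evalAt g f}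
  mul_mem' hx hy A _ _ h hh g := by rw [map_mul, map_mul, hx A h hh g, hy A h hh g]
  add_mem' hx hy A _ _ h hh g := by rw [map_add, map_add, hx A h hh g, hy A h hh g]
  algebraMap_mem' r A _ _ h hh g := by rw [AlgHom.commutes, AlgHom.commutes]

/-- For `ζ : {1,…,m} → {1,…,n}` the function `f^ζ(g₁,…,gₙ) = f(g_{ζ(1)},…,g_{ζ(m)})`. -/
def reindex {m n : ℕ} (ζ : Fin m → Fin n) (f : invariants O H m) : invariants O H n :=
  ⟨evalAt (fun i => coordPt O H n (ζ i)) f.1, by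
    intro A _ _ h hh g
    have key : ∀ g : Fin n → Pt O H A,
        evalAt g (evalAt (fun i => coordPt O H n (ζ i)) f.1) = evalAt (fun i => g (ζ i)) f.1 := by
      intro g
      rw [← AlgHom.comp_apply, algHom_comp_evalAt]
      simp only [map_evalAt_coordPt]
    rw [key, key]
    exact f.2 A h hh fun i => g (ζ i)⟩

/-- `(x₁,…,xₙ₊₁) ↦ (x₁,…,xₙ₋₁,xₙxₙ₊₁)`, where `n ≥ 1`. -/
def mulLast {X : Type*} [Mul X] {n : ℕ} (x : Fin (n + 2) → X) : Fin (n + 1) → X :=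
  Fin.contractNth (Fin.last n).castSucc (· * ·) x

theorem map_mulLast {X Y : Type*} [Monoid X] [Monoid Y] (f : X →* Y) {n : ℕ}
    (x : Fin (n + 2) → X) (i : Fin (n + 1)) :
    f (mulLast x i) = mulLast (fun j => f (x j)) i := by
  simp only [mulLast, Fin.contractNth]
  split_ifs <;> simp

/-- The function `f̂(g₁,…,gₙ₊₁) = f(g₁,…,gₙ₋₁,gₙgₙ₊₁)`, where `n ≥ 1`. -/
def hat {n : ℕ} (f : invariants O H (n + 1)) : invariants O H (n + 2) :=
  ⟨evalAt (mulLast (coordPt O H (n + 2))) f.1, by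
    intro A _ _ h hh g
    have key : ∀ g : Fin (n + 2) → Pt O H A,
        evalAt g (evalAt (mulLast (coordPt O H (n + 2))) f.1) = evalAt (mulLast g) f.1 := by
      intro g
      rw [← AlgHom.comp_apply, algHom_comp_evalAt]
      congr 2
      ext1 i
      rw [map_mulLast]
      simp only [map_evalAt_coordPt]
    rw [key, key, ← f.2 A h hh (mulLast g)]
    congr 2
    ext1 i
    exact (map_mulLast (MulAut.conj h).toMonoidHom g i).symm⟩

theorem evalAt_reindex {m n : ℕ} (ζ : Fin m → Fin n) (f : invariants O H m)
    (g : Fin n → Pt O H A) :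
    evalAt g (reindex ζ f).1 = evalAt (fun i => g (ζ i)) f.1 := by
  change evalAt g (evalAt (fun i => coordPt O H n (ζ i)) f.1) = _
  rw [← AlgHom.comp_apply, algHom_comp_evalAt]
  simp only [map_evalAt_coordPt]

theorem evalAt_hat {n : ℕ} (f : invariants O H (n + 1)) (g : Fin (n + 2) → Pt O H A) :
    evalAt g (hat f).1 = evalAt (mulLast g) f.1 := by
  change evalAt g (evalAt (mulLast (coordPt O H (n + 2))) f.1) = _
  rw [← AlgHom.comp_apply, algHom_comp_evalAt]
  congr 2
  ext1 i
  rw [map_mulLast]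
  simp only [map_evalAt_coordPt]

/-- Pullback of invariant functions along the morphism `Gⁿ → G'ⁿ` induced by a homomorphism of
group schemes `G → G'`. -/
def pullback {H' : Type u} [CommRing H'] [HopfAlgebra O H'] (φ : H' →ₐc[O] H) (n : ℕ) :
    invariants O H' n →ₐ[O] invariants O H n :=
  ((evalAt fun i => Pt.push φ (coordPt O H n i)).comp (invariants O H' n).val).codRestrict _ (by
    intro f A _ _ h hh g
    have key : ∀ g : Fin n → Pt O H A,
        evalAt g (evalAt (fun i => Pt.push φ (coordPt O H n i)) f.1) =
          evalAt (fun i => Pt.push φ (g i)) f.1 := by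
      intro g
      rw [← AlgHom.comp_apply, algHom_comp_evalAt]
      congr 2
      ext1 i
      rw [← map_evalAt_coordPt g i]
      rfl
    change evalAt _ (evalAt _ f.1) = evalAt _ (evalAt _ f.1)
    rw [key, key]
    simp only [map_mul, map_inv]
    exact f.2 A _ (push_mem_identityComponent φ hh) _)

end Points

/-! ### Pseudocharacters -/

section Pseudocharacters

variable (O : Type u) [CommRing O] (H : Type u) [CommRing H] [HopfAlgebra O H]
variable (Γ : Type u) [Group Γ]

/-- Lafforgue's `G`-pseudocharacters of `Γ` over `A`, for `G = Spec H`.  The component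
`Θ n` is the map `Θ_{n+1} : O[G^{n+1}]^{G⁰} → Map(Γ^{n+1}, A)`, so that `n + 1` runs through the
integers `≥ 1`. -/
@[ext]
structure PseudoChar (A : Type u) [CommRing A] [Algebra O A] where
  Θ : ∀ n : ℕ, invariants O H (n + 1) →ₐ[O] ((Fin (n + 1) → Γ) → A)
  reindex' : ∀ (m n : ℕ) (ζ : Fin (m + 1) → Fin (n + 1)) (f : invariants O H (m + 1))
    (γ : Fin (n + 1) → Γ), Θ n (reindex ζ f) γ = Θ m f (fun i => γ (ζ i))
  hat' : ∀ (n : ℕ) (f : invariants O H (n + 1)) (γ : Fin (n + 2) → Γ),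
    Θ (n + 1) (hat f) γ = Θ n f (mulLast γ)

variable {O H Γ}
variable {A B : Type u} [CommRing A] [Algebra O A] [CommRing B] [Algebra O B]

/-- Extension of scalars of pseudocharacters along `A → B`. -/
def PseudoChar.map (f : A →ₐ[O] B) (T : PseudoChar O H Γ A) : PseudoChar O H Γ B where
  Θ n := (f.compLeft (Fin (n + 1) → Γ)).comp (T.Θ n)
  reindex' m n ζ x γ := congrArg f (T.reindex' m n ζ x γ)
  hat' n x γ := congrArg f (T.hat' n x γ)

/-- The pseudocharacter `(γ₁,…,γₙ) ↦ f(ρ(γ₁),…,ρ(γₙ))` attached to a representation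
`ρ : Γ → G(A)`. -/
def PseudoChar.ofRep (ρ : Γ →* Pt O H A) : PseudoChar O H Γ A where
  Θ n := AlgHom.pi fun γ =>
    (evalAt fun i => ρ (γ i)).comp (invariants O H (n + 1)).val
  reindex' m n ζ f γ := evalAt_reindex ζ f _
  hat' n f γ := by
    refine (evalAt_hat f _).trans ?_
    have : mulLast (fun i => ρ (γ i)) = fun i => ρ (mulLast γ i) := by
      ext1 i
      exact (map_mulLast ρ γ i).symm
    rw [this]
    rfl

/-- The image of a pseudocharacter under a homomorphism of group schemes `G → G'`. -/
def PseudoChar.push {H' : Type u} [CommRing H'] [HopfAlgebra O H'] (φ : H' →ₐc[O] H)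
    (T : PseudoChar O H Γ A) : PseudoChar O H' Γ A where
  Θ n := (T.Θ n).comp (pullback φ (n + 1))
  reindex' m n ζ f γ := by
    have h : pullback φ (n + 1) (reindex ζ f) = reindex ζ (pullback φ (m + 1) f) := by
      apply Subtype.ext
      change evalAt _ (reindex ζ f).1 = evalAt _ (evalAt _ f.1)
      rw [evalAt_reindex, ← AlgHom.comp_apply, algHom_comp_evalAt]
      congr 2
      ext1 i
      exact congrArg (Pt.push φ)
        (map_evalAt_coordPt (fun i => coordPt O H (n + 1) (ζ i)) i).symm
    exact (congrArg (fun z => T.Θ n z γ) h).trans (T.reindex' m n ζ _ γ)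
  hat' n f γ := by
    have h : pullback φ (n + 2) (hat f) = hat (pullback φ (n + 1) f) := by
      apply Subtype.ext
      change evalAt _ (hat f).1 = evalAt _ (evalAt _ f.1)
      rw [evalAt_hat, ← AlgHom.comp_apply, algHom_comp_evalAt]
      congr 2
      ext1 i
      rw [← map_mulLast]
      exact congrArg (Pt.push φ) (map_evalAt_coordPt (mulLast (coordPt O H (n + 2))) i).symm
    exact (congrArg (fun z => T.Θ (n + 1) z γ) h).trans (T.hat' n _ γ)

theorem PseudoChar.map_ofRep (f : A →ₐ[O] B) (ρ : Γ →* Pt O H A) :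
    (PseudoChar.ofRep ρ).map f = PseudoChar.ofRep ((Pt.map H f).comp ρ) := by
  refine PseudoChar.ext (funext fun n => AlgHom.ext fun x => funext fun γ => ?_)
  exact DFunLike.congr_fun (algHom_comp_evalAt f fun i => ρ (γ i)) x.1

theorem PseudoChar.push_ofRep {H' : Type u} [CommRing H'] [HopfAlgebra O H'] (φ : H' →ₐc[O] H)
    (ρ : Γ →* Pt O H A) :
    (PseudoChar.ofRep ρ).push φ = PseudoChar.ofRep ((Pt.push φ).comp ρ) := by
  refine PseudoChar.ext (funext fun n => AlgHom.ext fun x => funext fun γ => ?_)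
  change evalAt (fun i => ρ (γ i)) (evalAt (fun i => Pt.push φ (coordPt O H (n + 1) i)) x.1) =
    evalAt (fun i => Pt.push φ (ρ (γ i))) x.1
  rw [← AlgHom.comp_apply, algHom_comp_evalAt]
  congr 2
  ext1 i
  exact congrArg (Pt.push φ) (map_evalAt_coordPt (fun i => ρ (γ i)) i)

end Pseudocharacters

/-! ### Constant group schemes -/

section Constant

/-- The coordinate ring `Map(Δ, O)` of the constant group scheme attached to a finite group `Δ`.
(A synonym of `Δ → O`, since the comultiplication depends on the group `Δ`.) -/
def ConstAlg (O Δ : Type u) : Type u := Δ → O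

namespace ConstAlg

variable {O Δ : Type u} [CommRing O]

instance : CommRing (ConstAlg O Δ) := inferInstanceAs (CommRing (Δ → O))

instance : Algebra O (ConstAlg O Δ) := inferInstanceAs (Algebra O (Δ → O))

open scoped Classical in
/-- The indicator function of an element of `Δ`. -/
def ind (s : Δ) : ConstAlg O Δ := fun t => if t = s then 1 else 0

/-- Evaluation at `s ∈ Δ`. -/
def ev (s : Δ) : ConstAlg O Δ →ₐ[O] O := Pi.evalAlgHom O (fun _ : Δ => O) s

theorem ext_ev {f g : ConstAlg O Δ} (h : ∀ s, ev s f = ev s g) : f = g := funext h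

open scoped Classical in
theorem ev_ind (s t : Δ) : ev (O := O) t (ind s) = if t = s then 1 else 0 := rfl

open scoped Classical in
theorem ind_mul_ind (s t : Δ) :
    (ind s * ind t : ConstAlg O Δ) = if s = t then ind s else 0 := by
  apply ext_ev
  intro r
  rw [map_mul, ev_ind, ev_ind]
  split_ifs with h1 h2 h3 h4 h5 <;> simp_all [ev_ind]

theorem sum_ind [Fintype Δ] (f : ConstAlg O Δ) : ∑ s, ev s f • ind s = f := by
  classical
  apply ext_ev
  intro r
  simp [map_sum, ev_ind]

variable [Group Δ]

/-- The antipode `f ↦ (s ↦ f s⁻¹)`. -/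
def antipodeMap : ConstAlg O Δ →ₗ[O] ConstAlg O Δ where
  toFun f := fun s => f s⁻¹
  map_add' _ _ := rfl
  map_smul' _ _ := rfl

theorem ev_antipodeMap (s : Δ) (f : ConstAlg O Δ) : ev s (antipodeMap f) = ev s⁻¹ f := rfl

variable [Finite Δ]

/-- The comultiplication of `Map(Δ, O)`: it sends `f` to `(s, t) ↦ f (s * t)` under the
identification of `Map(Δ, O) ⊗ Map(Δ, O)` with `Map(Δ × Δ, O)`. -/
def comulHom : ConstAlg O Δ →ₐ[O] ConstAlg O Δ ⊗[O] ConstAlg O Δ :=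
  letI := Fintype.ofFinite Δ
  AlgHom.ofLinearMap
    { toFun := fun f => ∑ s : Δ, ∑ t : Δ, ev (s * t) f • (ind s ⊗ₜ[O] ind t)
      map_add' := fun f g => by simp [add_smul, Finset.sum_add_distrib]
      map_smul' := fun r f => by simp [mul_smul, Finset.smul_sum] }
    (by
      have h : ∑ s : Δ, (ind s : ConstAlg O Δ) = 1 := by simpa using sum_ind (1 : ConstAlg O Δ)
      simp only [LinearMap.coe_mk, AddHom.coe_mk, map_one, one_smul]
      simp_rw [← TensorProduct.tmul_sum, ← TensorProduct.sum_tmul, h]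
      rfl)
    (fun f g => by
      classical
      simp only [LinearMap.coe_mk, AddHom.coe_mk, map_mul, Finset.sum_mul, Finset.mul_sum,
        smul_mul_smul_comm, Algebra.TensorProduct.tmul_mul_tmul, ind_mul_ind]
      refine Finset.sum_congr rfl fun s _ => Finset.sum_congr rfl fun t _ => ?_
      rw [Finset.sum_eq_single s, Finset.sum_eq_single t]
      · simp
      · intro b _ hb
        rw [if_neg hb, TensorProduct.tmul_zero, smul_zero]
      · simp
      · intro b _ hb
        refine Finset.sum_eq_zero fun c _ => ?_
        rw [if_neg hb, TensorProduct.zero_tmul, smul_zero]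
      · simp)

theorem comulHom_apply (f : ConstAlg O Δ) :
    letI := Fintype.ofFinite Δ
    comulHom f = ∑ s : Δ, ∑ t : Δ, ev (s * t) f • (ind s ⊗ₜ[O] ind t) := rfl

instance : Bialgebra O (ConstAlg O Δ) :=
  letI := Fintype.ofFinite Δ
  Bialgebra.ofAlgHom comulHom (ev 1)
    (by
      classical
      ext f
      have h1 : (Algebra.TensorProduct.map comulHom (AlgHom.id O (ConstAlg O Δ))) (comulHom f) =
          ∑ a : Δ, ∑ b : Δ, ∑ t : Δ, ev (a * b * t) f • ((ind a ⊗ₜ[O] ind b) ⊗ₜ[O] ind t) := by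
        rw [comulHom_apply f]
        simp only [map_sum, map_smul, Algebra.TensorProduct.map_tmul, AlgHom.id_apply,
          comulHom_apply (ind _), TensorProduct.sum_tmul, ev_ind, ite_smul, one_smul, zero_smul,
          TensorProduct.ite_tmul, Finset.smul_sum, smul_ite, smul_zero]
        trans ∑ t : Δ, ∑ a : Δ, ∑ b : Δ, ev (a * b * t) f • ((ind a ⊗ₜ[O] ind b) ⊗ₜ[O] ind t)
        · rw [Finset.sum_comm]
          refine Finset.sum_congr rfl fun t _ => ?_
          rw [Finset.sum_comm]
          refine Finset.sum_congr rfl fun a _ => ?_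
          rw [Finset.sum_comm]
          refine Finset.sum_congr rfl fun b _ => ?_
          simp
        · rw [Finset.sum_comm]
          refine Finset.sum_congr rfl fun a _ => ?_
          exact Finset.sum_comm
      have h2 : (Algebra.TensorProduct.map (AlgHom.id O (ConstAlg O Δ)) comulHom) (comulHom f) =
          ∑ a : Δ, ∑ b : Δ, ∑ t : Δ, ev (a * b * t) f • (ind a ⊗ₜ[O] (ind b ⊗ₜ[O] ind t)) := by
        rw [comulHom_apply f]
        simp only [map_sum, map_smul, Algebra.TensorProduct.map_tmul, AlgHom.id_apply,
          comulHom_apply (ind _), TensorProduct.tmul_sum, ev_ind, ite_smul, one_smul, zero_smul,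
          TensorProduct.tmul_ite, Finset.smul_sum, smul_ite, smul_zero]
        refine Finset.sum_congr rfl fun a _ => ?_
        rw [Finset.sum_comm]
        refine Finset.sum_congr rfl fun b _ => ?_
        rw [Finset.sum_comm]
        simp [mul_assoc]
      simp only [AlgHom.comp_apply, h1, h2, map_sum, map_smul]
      rfl)
    (by
      classical
      ext f
      have : (Algebra.TensorProduct.map (ev 1) (AlgHom.id O (ConstAlg O Δ))) (comulHom f) =
          1 ⊗ₜ[O] f := by
        rw [comulHom_apply f]
        simp only [map_sum, map_smul, Algebra.TensorProduct.map_tmul, AlgHom.id_apply, ev_ind]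
        rw [Finset.sum_eq_single 1]
        · conv_rhs => rw [← sum_ind f]
          simp [TensorProduct.tmul_sum]
        · intro b _ hb
          simp [Ne.symm hb]
        · simp
      simpa using this)
    (by
      classical
      ext f
      have : (Algebra.TensorProduct.map (AlgHom.id O (ConstAlg O Δ)) (ev 1)) (comulHom f) =
          f ⊗ₜ[O] 1 := by
        rw [comulHom_apply f]
        simp only [map_sum, map_smul, Algebra.TensorProduct.map_tmul, AlgHom.id_apply, ev_ind]
        conv_rhs => rw [← sum_ind f]
        rw [TensorProduct.sum_tmul]
        refine Finset.sum_congr rfl fun s _ => ?_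
        rw [Finset.sum_eq_single 1]
        · simp [TensorProduct.smul_tmul']
        · intro b _ hb
          simp [Ne.symm hb]
        · simp
      simpa using this)

theorem comul_apply (f : ConstAlg O Δ) : Coalgebra.comul (R := O) f = comulHom f := rfl

theorem counit_apply (f : ConstAlg O Δ) : Coalgebra.counit (R := O) f = ev 1 f := rfl

instance : HopfAlgebra O (ConstAlg O Δ) where
  antipode := antipodeMap
  mul_antipode_rTensor_comul := by
    classical
    let _ := Fintype.ofFinite Δ
    ext f
    apply ext_ev
    intro r
    simp only [LinearMap.comp_apply, comul_apply, comulHom_apply, counit_apply, map_sum, map_smul,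
      LinearMap.rTensor_tmul, LinearMap.mul'_apply, map_mul, ev_antipodeMap, ev_ind]
    rw [Finset.sum_eq_single r⁻¹, Finset.sum_eq_single r]
    · simp
    · intro b _ hb
      simp [Ne.symm hb]
    · simp
    · intro b _ hb
      simp [Ne.symm hb]
    · simp
  mul_antipode_lTensor_comul := by
    classical
    let _ := Fintype.ofFinite Δ
    ext f
    apply ext_ev
    intro r
    simp only [LinearMap.comp_apply, comul_apply, comulHom_apply, counit_apply, map_sum, map_smul,
      LinearMap.lTensor_tmul, LinearMap.mul'_apply, map_mul, ev_antipodeMap, ev_ind]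
    rw [Finset.sum_eq_single r, Finset.sum_eq_single r⁻¹]
    · simp
    · intro b _ hb
      simp [Ne.symm hb]
    · simp
    · intro b _ hb
      simp [Ne.symm hb]
    · simp

end ConstAlg

end Constant

/-! ### Split generalised tori -/

section Torus

variable {O M Δ A B : Type u} [CommRing O] [AddCommGroup M] [Group Δ]
  [CommRing A] [Algebra O A] [CommRing B] [Algebra O B]

variable (O) in
/-- The `A`-point of the constant group scheme given by an element of `Δ`. -/
def constPt [Finite Δ] (A : Type u) [CommRing A] [Algebra O A] :
    Δ →* Pt O (ConstAlg O Δ) A where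
  toFun s := toConv ((Algebra.ofId O A).comp (ConstAlg.ev s))
  map_one' := rfl
  map_mul' s t := by
    classical
    let _ := Fintype.ofFinite Δ
    apply ofConv_injective
    ext f
    change _ = (WithConv.toConv ((Algebra.ofId O A).comp (ConstAlg.ev s)) *
      WithConv.toConv ((Algebra.ofId O A).comp (ConstAlg.ev t)) :
        WithConv (ConstAlg O Δ →ₐ[O] A)).ofConv f
    rw [AlgHom.convMul_def]
    simp only [AlgHom.comp_apply, Bialgebra.comulAlgHom_apply, ConstAlg.comul_apply,
      ConstAlg.comulHom_apply, map_sum, map_smul, Algebra.TensorProduct.map_tmul,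
      Algebra.TensorProduct.lmul'_apply_tmul, ConstAlg.ev_ind]
    rw [Finset.sum_eq_single s, Finset.sum_eq_single t]
    · simp [Algebra.ofId_apply, Algebra.algebraMap_eq_smul_one]
    · intro b _ hb
      simp [Ne.symm hb]
    · simp
    · intro b _ hb
      simp [Ne.symm hb]
    · simp

theorem map_constPt [Finite Δ] (f : A →ₐ[O] B) (s : Δ) :
    Pt.map (ConstAlg O Δ) f (constPt O A s) = constPt O B s := by
  apply ofConv_injective
  ext x
  exact f.commutes _

/-- The group `𝔇(M)(A) = Hom(M, Aˣ)` of `A`-points of the diagonalisable group scheme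
`𝔇(M) = Spec O[M]`. -/
def TorusPt (M A : Type u) [AddCommGroup M] [CommRing A] : Type u := Multiplicative M →* Aˣ

instance : CommGroup (TorusPt M A) := inferInstanceAs (CommGroup (Multiplicative M →* Aˣ))

/-- The value of `t ∈ Hom(M, Aˣ)` at `m ∈ M`. -/
def TorusPt.val (t : TorusPt M A) (m : M) : Aˣ :=
  (show Multiplicative M →* Aˣ from t) (Multiplicative.ofAdd m)

/-- The map `Hom(M, Aˣ) → Hom(M, Bˣ)` induced by `A → B`. -/
def TorusPt.map (f : A →ₐ[O] B) : TorusPt M A →* TorusPt M B where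
  toFun t := (Units.map (f : A →* B)).comp (show Multiplicative M →* Aˣ from t)
  map_one' := MonoidHom.comp_one _
  map_mul' _ _ := MonoidHom.comp_mul _ _ _

/-- `Δ` acts on `Hom(M, Aˣ)` by `(δ • t)(m) = t(δ⁻¹ m)`. -/
instance [DistribMulAction Δ M] : MulDistribMulAction Δ (TorusPt M A) where
  smul δ t := (show Multiplicative M →* Aˣ from t).comp
    (AddMonoidHom.toMultiplicative (DistribSMul.toAddMonoidHom M δ⁻¹))
  one_smul t := MonoidHom.ext fun m => by
    change t.val ((1 : Δ)⁻¹ • m.toAdd) = t.val m.toAdd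
    rw [inv_one, one_smul]
  mul_smul δ ε t := MonoidHom.ext fun m => by
    change t.val ((δ * ε)⁻¹ • m.toAdd) = t.val (ε⁻¹ • δ⁻¹ • m.toAdd)
    rw [mul_inv_rev, mul_smul]
  smul_mul _ _ _ := rfl
  smul_one _ := rfl

theorem TorusPt.smul_val [DistribMulAction Δ M] (δ : Δ) (t : TorusPt M A) (m : M) :
    (δ • t).val m = t.val (δ⁻¹ • m) := rfl

theorem TorusPt.map_smul [DistribMulAction Δ M] (f : A →ₐ[O] B) (δ : Δ) (t : TorusPt M A) :
    TorusPt.map f (δ • t) = δ • TorusPt.map f t := rfl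

variable (O) in
/-- The identification of `Hom(M, Aˣ)` with the group of `A`-points of `Spec O[M]`. -/
def TorusPt.toPt : TorusPt M A →* Pt O (AddMonoidAlgebra O M) A where
  toFun t := AddMonoidAlgebra.liftMulEquiv O A M ((Units.coeHom A).comp t)
  map_one' := map_one (AddMonoidAlgebra.liftMulEquiv O A M)
  map_mul' s t := map_mul (AddMonoidAlgebra.liftMulEquiv O A M)
    ((Units.coeHom A).comp s) ((Units.coeHom A).comp t)

theorem TorusPt.toPt_map (f : A →ₐ[O] B) (t : TorusPt M A) :
    TorusPt.toPt O (TorusPt.map f t) = Pt.map _ f (TorusPt.toPt O t) := by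
  apply ofConv_injective
  refine AddMonoidAlgebra.algHom_ext (fun m => ?_) (Subsingleton.elim _ _)
  change AddMonoidAlgebra.lift O B M ((Units.coeHom B).comp ((Units.map (f : A →* B)).comp t))
    (AddMonoidAlgebra.single m 1) =
      f (AddMonoidAlgebra.lift O A M ((Units.coeHom A).comp t) (AddMonoidAlgebra.single m 1))
  rw [AddMonoidAlgebra.lift_single, AddMonoidAlgebra.lift_single, one_smul, one_smul]
  rfl

variable (O M Δ) in
/-- A generalised torus `G = Spec H` over `O` (a smooth affine group scheme) whose identity
component `G⁰` is the split torus `𝔇(M)`, where `M` is a free abelian group of finite rank, and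
whose component group `G/G⁰` is the constant group scheme attached to the finite group `Δ`.

* `incl` is the inclusion `𝔇(M) → G`; it identifies `𝔇(M)` with `G⁰`.
* `proj` is the projection `Π : G → G/G⁰`; it has kernel `G⁰` and is surjective as a map of fpqc
  sheaves. -/
structure SplitGeneralisedTorus (H : Type u) [CommRing H] [HopfAlgebra O H] [Finite Δ] where
  smooth : Algebra.Smooth O H
  free : Module.Free ℤ M
  finite : Module.Finite ℤ M
  incl : H →ₐc[O] AddMonoidAlgebra O M
  incl_injective : ∀ (A : Type u) [CommRing A] [Algebra O A],
    Function.Injective fun t : TorusPt M A => Pt.push incl (TorusPt.toPt O t)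
  range_incl : ∀ (A : Type u) [CommRing A] [Algebra O A],
    (Set.range fun t : TorusPt M A => Pt.push incl (TorusPt.toPt O t)) = identityComponent O H A
  proj : ConstAlg O Δ →ₐc[O] H
  proj_eq_one_iff : ∀ (A : Type u) [CommRing A] [Algebra O A] (g : Pt O H A),
    Pt.push proj g = 1 ↔ g ∈ identityComponent O H A
  proj_surjective : ∀ (A : Type u) [CommRing A] [Algebra O A] (x : Pt O (ConstAlg O Δ) A),
    ∃ (B : Type u) (_ : CommRing B) (_ : Algebra O B) (f : A →ₐ[O] B) (g : Pt O H B),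
      f.toRingHom.FaithfullyFlat ∧ Pt.push proj g = Pt.map _ f x

namespace SplitGeneralisedTorus

variable {H : Type u} [CommRing H] [HopfAlgebra O H] [Finite Δ]
  (G : SplitGeneralisedTorus O M Δ H)

/-- The inclusion `𝔇(M)(A) → G(A)`. -/
def ι (A : Type u) [CommRing A] [Algebra O A] : TorusPt M A →* Pt O H A :=
  (Pt.push G.incl).comp (TorusPt.toPt O)

/-- The projection `Π : G(A) → (G/G⁰)(A)`. -/
def Proj (A : Type u) [CommRing A] [Algebra O A] : Pt O H A →* Pt O (ConstAlg O Δ) A :=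
  Pt.push G.proj

theorem Proj_ι (t : TorusPt M A) : G.Proj A (G.ι A t) = 1 :=
  (G.proj_eq_one_iff A _).2 (G.range_incl A ▸ ⟨t, rfl⟩)

theorem ι_map (f : A →ₐ[O] B) (t : TorusPt M A) :
    G.ι B (TorusPt.map f t) = Pt.map H f (G.ι A t) := by
  simp only [ι, MonoidHom.comp_apply, TorusPt.toPt_map]
  rfl

/-- The given action of `Δ` on the character lattice `M` of `G⁰` is the one induced by the
conjugation action of `G` on `G⁰`: if `g ∈ G(A)` lies over `δ ∈ Δ`, then conjugation by `g` is the
automorphism `t ↦ δ • t` of `G⁰(A) = Hom(M, Aˣ)`, where `(δ • t)(m) = t(δ⁻¹ m)`. -/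
def IsConjugationAction [DistribMulAction Δ M] : Prop :=
  ∀ (A : Type u) [CommRing A] [Algebra O A] (g : Pt O H A) (δ : Δ),
    G.Proj A g = constPt O A δ → ∀ t : TorusPt M A, g * G.ι A t * g⁻¹ = G.ι A (δ • t)

/-! ### Admissible representations and admissible pseudocharacters -/

variable {Γ : Type u} [Group Γ] (π : Γ →* Δ)

/-- The set of admissible representations `ρ : Γ → G(A)`, i.e. those with `Π ∘ ρ = π`. -/
def Rep (A : Type u) [CommRing A] [Algebra O A] : Type u :=
  {ρ : Γ →* Pt O H A // ∀ γ, G.Proj A (ρ γ) = constPt O A (π γ)}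

variable {π}

/-- Extension of scalars of admissible representations. -/
def Rep.map (f : A →ₐ[O] B) (ρ : G.Rep π A) : G.Rep π B :=
  ⟨(Pt.map H f).comp ρ.1, fun γ =>
    (congrArg (Pt.map (ConstAlg O Δ) f) (ρ.2 γ)).trans (map_constPt f (π γ))⟩

/-- The group `𝔇(M)(A) = G⁰(A)` acts on the admissible representations by conjugation. -/
instance : MulAction (TorusPt M A) (G.Rep π A) where
  smul t ρ := ⟨(MulAut.conj (G.ι A t)).toMonoidHom.comp ρ.1, fun γ => by
    change G.Proj A (G.ι A t * ρ.1 γ * (G.ι A t)⁻¹) = _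
    rw [map_mul, map_mul, map_inv, Proj_ι, one_mul, inv_one, mul_one, ρ.2 γ]⟩
  one_smul ρ := Subtype.ext (MonoidHom.ext fun γ => by
    change G.ι A 1 * ρ.1 γ * (G.ι A 1)⁻¹ = ρ.1 γ
    simp)
  mul_smul s t ρ := Subtype.ext (MonoidHom.ext fun γ => by
    change G.ι A (s * t) * ρ.1 γ * (G.ι A (s * t))⁻¹ =
      G.ι A s * (G.ι A t * ρ.1 γ * (G.ι A t)⁻¹) * (G.ι A s)⁻¹
    simp [mul_assoc])

theorem Rep.smul_apply (t : TorusPt M A) (ρ : G.Rep π A) (γ : Γ) :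
    (t • ρ).1 γ = G.ι A t * ρ.1 γ * (G.ι A t)⁻¹ := rfl

theorem Rep.map_smul (f : A →ₐ[O] B) (t : TorusPt M A) (ρ : G.Rep π A) :
    Rep.map G f (t • ρ) = TorusPt.map f t • Rep.map G f ρ :=
  Subtype.ext (MonoidHom.ext fun γ => by
    rw [Rep.smul_apply, ι_map]
    change Pt.map H f (G.ι A t * ρ.1 γ * (G.ι A t)⁻¹) = _
    rw [map_mul, map_mul, map_inv]
    rfl)

variable (π) in
/-- The functor `A ↦ Rep(A)` of admissible representations. -/
def repFunctor : CommAlgCat.{u} O ⥤ Type u where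
  obj A := G.Rep π A
  map f := TypeCat.ofHom (Rep.map G f.hom)

/-- The map on sets of orbits induced by extension of scalars. -/
def orbitMap (f : A →ₐ[O] B) :
    MulAction.orbitRel.Quotient (TorusPt M A) (G.Rep π A) →
      MulAction.orbitRel.Quotient (TorusPt M B) (G.Rep π B) :=
  Quotient.map (Rep.map G f) (by
    rintro _ ρ ⟨t, rfl⟩
    exact ⟨TorusPt.map f t, (Rep.map_smul G f t ρ).symm⟩)

variable (π) in
/-- The presheaf quotient `A ↦ Rep(A) / 𝔇(M)(A)`. -/
def orbitFunctor : CommAlgCat.{u} O ⥤ Type u where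
  obj A := MulAction.orbitRel.Quotient (TorusPt M A) (G.Rep π A)
  map f := TypeCat.ofHom (orbitMap G f.hom)
  map_id A := by
    ext x
    induction x using Quotient.inductionOn
    rfl
  map_comp f g := by
    ext x
    induction x using Quotient.inductionOn
    rfl

variable (π) in
/-- The set of admissible `G`-pseudocharacters: those whose image under `Π : G → Δ` is the
pseudocharacter attached to `π`. -/
def PC (A : Type u) [CommRing A] [Algebra O A] : Type u :=
  {T : PseudoChar O H Γ A // T.push G.proj = PseudoChar.ofRep ((constPt O A).comp π)}

/-- Extension of scalars of admissible pseudocharacters. -/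
def PC.map (f : A →ₐ[O] B) (T : G.PC π A) : G.PC π B :=
  ⟨T.1.map f, by
    have h : (PseudoChar.ofRep ((constPt O A).comp π)).map f =
        PseudoChar.ofRep ((constPt O B).comp π) := by
      rw [PseudoChar.map_ofRep]
      congr 1
      exact MonoidHom.ext fun γ => map_constPt f (π γ)
    exact (congrArg (PseudoChar.map f) T.2).trans h⟩

/-- The admissible pseudocharacter attached to an admissible representation. -/
def PC.ofRep (ρ : G.Rep π A) : G.PC π A :=
  ⟨PseudoChar.ofRep ρ.1, by
    rw [PseudoChar.push_ofRep]
    congr 1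
    exact MonoidHom.ext ρ.2⟩

variable (π) in
/-- The functor `A ↦ PC(A)` of admissible pseudocharacters. -/
def pcFunctor : CommAlgCat.{u} O ⥤ Type u where
  obj A := G.PC π A
  map f := TypeCat.ofHom (PC.map G f.hom)

variable (π) in
/-- If `R` represents `Rep`, so that `R` is the coordinate ring of the scheme `Rep`, this is the
algebra of `G⁰`-invariant functions on `Rep`, i.e. the coordinate ring of the GIT quotient
`Rep // G⁰`.  A function `r` is invariant if `r(t • ρ) = r(ρ)` for all `O`-algebras `A`, all
`t ∈ G⁰(A)` and all `ρ ∈ Rep(A)`. -/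
def repInvariants {R : CommAlgCat.{u} O} (c : (G.repFunctor π).CorepresentableBy R) :
    Subalgebra O R where
  carrier := {r | ∀ (A : CommAlgCat.{u} O) (t : TorusPt M A) (ρ : G.Rep π A),
    (c.homEquiv.symm (t • ρ : G.Rep π A)).hom r = (c.homEquiv.symm ρ).hom r}
  mul_mem' hx hy A t ρ := by rw [map_mul, map_mul, hx A t ρ, hy A t ρ]
  add_mem' hx hy A t ρ := by rw [map_add, map_add, hx A t ρ, hy A t ρ]
  algebraMap_mem' r A t ρ := by rw [AlgHom.commutes, AlgHom.commutes]

end SplitGeneralisedTorus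

end Torus

/-! ### Cocycles -/

section Cocycles

variable {Γ Δ : Type u} [Group Γ] [Group Δ] (π : Γ →* Δ)
  (M : Type u) [AddCommGroup M] [DistribMulAction Δ M]

/-- The group `Z¹(Γ, 𝔇(M)(A))` of `1`-cocycles, where `Γ` acts on `𝔇(M)(A) = Hom(M, Aˣ)` through
`π : Γ → Δ`. -/
def Z1 (A : Type u) [CommRing A] : Subgroup (Γ → TorusPt M A) where
  carrier := {Φ | ∀ γ γ', Φ (γ * γ') = Φ γ * π γ • Φ γ'}
  one_mem' γ γ' := by simp
  mul_mem' {Φ Ψ} hΦ hΨ γ γ' := by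
    simp only [Pi.mul_apply, hΦ γ γ', hΨ γ γ', smul_mul']
    exact mul_mul_mul_comm _ _ _ _
  inv_mem' {Φ} hΦ γ γ' := by
    simp only [Pi.inv_apply, hΦ γ γ', smul_inv', mul_inv]

variable {M} in
/-- The coboundary `γ ↦ t · (γ t)⁻¹` of `t ∈ 𝔇(M)(A)`. -/
def coboundary {A : Type u} [CommRing A] : TorusPt M A →* Z1 π M A where
  toFun t := ⟨fun γ => t * (π γ • t)⁻¹, fun γ γ' => by
    simp [mul_smul, smul_mul', smul_inv', mul_assoc]⟩
  map_one' := by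
    apply Subtype.ext
    funext γ
    simp
  map_mul' s t := by
    apply Subtype.ext
    funext γ
    simp only [smul_mul', mul_inv]
    exact mul_mul_mul_comm _ _ _ _

/-- The group `B¹(Γ, 𝔇(M)(A))` of `1`-coboundaries. -/
def B1 (A : Type u) [CommRing A] : Subgroup (Z1 π M A) := (coboundary π).range

/-- The group `H¹(Γ, 𝔇(M)(A))`. -/
abbrev H1 (A : Type u) [CommRing A] : Type u := Z1 π M A ⧸ B1 π M A

variable {O : Type u} [CommRing O] {A B : Type u} [CommRing A] [Algebra O A] [CommRing B]
  [Algebra O B]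

variable {M} in
/-- The map on cocycles induced by `A → B`. -/
def Z1.map (f : A →ₐ[O] B) : Z1 π M A →* Z1 π M B where
  toFun Φ := ⟨fun γ => TorusPt.map f (Φ.1 γ), fun γ γ' => by
    change TorusPt.map f (Φ.1 (γ * γ')) = TorusPt.map f (Φ.1 γ) * π γ • TorusPt.map f (Φ.1 γ')
    rw [Φ.2 γ γ', map_mul, TorusPt.map_smul]⟩
  map_one' := Subtype.ext (funext fun _ => map_one (TorusPt.map f))
  map_mul' Φ Ψ := Subtype.ext (funext fun γ => map_mul (TorusPt.map f) (Φ.1 γ) (Ψ.1 γ))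

variable {M} in
/-- The map on `H¹` induced by `A → B`. -/
def H1.map (f : A →ₐ[O] B) : H1 π M A →* H1 π M B :=
  QuotientGroup.map _ _ (Z1.map π f) (by
    rintro _ ⟨t, rfl⟩
    refine ⟨TorusPt.map f t, Subtype.ext (funext fun γ => ?_)⟩
    change TorusPt.map f t * (π γ • TorusPt.map f t)⁻¹ = TorusPt.map f (t * (π γ • t)⁻¹)
    rw [map_mul, map_inv, TorusPt.map_smul])

variable (O) in
/-- The functor `A ↦ Z¹(Γ, 𝔇(M)(A))`. -/
def z1Functor : CommAlgCat.{u} O ⥤ Type u where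
  obj A := Z1 π M A
  map f := TypeCat.ofHom (Z1.map π f.hom)

variable (O) in
/-- The functor `A ↦ H¹(Γ, 𝔇(M)(A))`. -/
def h1Functor : CommAlgCat.{u} O ⥤ Type u where
  obj A := H1 π M A
  map f := TypeCat.ofHom (H1.map π f.hom)
  map_id A := by
    ext x
    induction x using QuotientGroup.induction_on
    rfl
  map_comp f g := by
    ext x
    induction x using QuotientGroup.induction_on
    rfl

/-! ### Group homology -/

/-- The differential `C₁(Γ, M) → C₀(Γ, M)` of the inhomogeneous chain complex,
`m·[γ] ↦ γ⁻¹ m - m`; the group `Γ` acts on `M` through `π`. -/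
def d₁ : (Γ →₀ M) →+ M :=
  Finsupp.liftAddHom fun γ => DistribSMul.toAddMonoidHom M (π γ)⁻¹ - AddMonoidHom.id M

/-- The differential `C₂(Γ, M) → C₁(Γ, M)` of the inhomogeneous chain complex,
`m·[γ, γ'] ↦ γ⁻¹m·[γ'] - m·[γγ'] + m·[γ]`. -/
def d₂ : (Γ × Γ →₀ M) →+ (Γ →₀ M) :=
  Finsupp.liftAddHom fun p =>
    (Finsupp.singleAddHom p.2).comp (DistribSMul.toAddMonoidHom M (π p.1)⁻¹) -
      Finsupp.singleAddHom (p.1 * p.2) + Finsupp.singleAddHom p.1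

/-- The homology group `H₁(Γ, M)`. -/
abbrev HomologyOne : Type u := (d₁ π M).ker ⧸ (d₂ π M).range.addSubgroupOf (d₁ π M).ker

end Cocycles

/-! ### The module `ℰ` -/

section ModuleE

variable {Γ Δ : Type u} [Group Γ] [Group Δ]

/-- A choice of a representative `c̄ ∈ Γ` of each coset `c ∈ Δ = Γ/ker π`, such that the trivial
coset is represented by `1`. -/
structure CosetReps (π : Γ →* Δ) where
  rep : Δ → Γ
  π_rep : ∀ c, π (rep c) = c
  rep_one : rep 1 = 1

variable (Δ) in
/-- The augmentation ideal `I_Δ` of the group ring `ℤ[Δ]`. -/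
abbrev AugIdeal : Submodule ℤ (Δ →₀ ℤ) :=
  LinearMap.ker (Finsupp.linearCombination ℤ fun _ : Δ => (1 : ℤ))

/-- The abelian group `Γ₂^ab`, written additively, where `Γ₂ = ker π`. -/
abbrev KerAb (π : Γ →* Δ) : Type u := Additive (Abelianization π.ker)

/-- The image in `Γ₂^ab` of an element of `Γ₂ = ker π`. -/
def kerMk (π : Γ →* Δ) (k : π.ker) : KerAb π := Additive.ofMul (Abelianization.of k)

/-- The abelian group underlying `ℰ`, namely `Γ₂^ab ⊕ I_Δ`. -/
abbrev ModE (π : Γ →* Δ) : Type u := KerAb π × AugIdeal Δ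

/-- Conjugation `k ↦ g k g⁻¹` on `Γ₂^ab`, for `g ∈ Γ`. -/
def conjKer (π : Γ →* Δ) (g : Γ) : KerAb π →ₗ[ℤ] KerAb π :=
  (MonoidHom.toAdditive
    (Abelianization.map (MulAut.conjNormal (H := π.ker) g).toMonoidHom)).toIntLinearMap

theorem conjKer_kerMk (π : Γ →* Δ) (g : Γ) (k : π.ker) :
    conjKer π g (kerMk π k) = kerMk π (MulAut.conjNormal g k) := rfl

theorem kerMk_mul (π : Γ →* Δ) (k l : π.ker) : kerMk π (k * l) = kerMk π k + kerMk π l := rfl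

theorem kerMk_induction (π : Γ →* Δ) {P : KerAb π → Prop} (h : ∀ k, P (kerMk π k)) (x : KerAb π) :
    P x := by
  obtain ⟨k, hk⟩ := QuotientGroup.mk_surjective (Additive.toMul x)
  have : x = kerMk π k := congrArg Additive.ofMul hk.symm
  exact this ▸ h k

theorem conjKer_mul (π : Γ →* Δ) (g h : Γ) (x : KerAb π) :
    conjKer π (g * h) x = conjKer π g (conjKer π h x) := by
  induction x using kerMk_induction with
  | h k => simp [conjKer_kerMk]

theorem conjKer_of_mem (π : Γ →* Δ) (g : Γ) (hg : g ∈ π.ker) (x : KerAb π) :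
    conjKer π g x = x := by
  induction x using kerMk_induction with
  | h k =>
    have : (MulAut.conjNormal g k : π.ker) = ⟨g, hg⟩ * k * ⟨g, hg⟩⁻¹ := by
      apply Subtype.ext
      simp [MulAut.conjNormal_apply]
    rw [conjKer_kerMk, this, kerMk_mul, kerMk_mul, add_right_comm, ← kerMk_mul, mul_inv_cancel]
    exact zero_add _

namespace CosetReps

variable {π : Γ →* Δ} (s : CosetReps π)

/-- The `2`-cocycle `κ(d, c) ∈ Γ₂^ab`, the image of `d̄ c̄ (dc)‾⁻¹`. -/
def κ (d c : Δ) : KerAb π :=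
  kerMk π ⟨s.rep d * s.rep c * (s.rep (d * c))⁻¹, by
    simp [MonoidHom.mem_ker, s.π_rep]⟩

/-- The additive extension `ℤ[Δ] → Γ₂^ab` of `c ↦ κ(d, c)`. As `κ(d, 1) = 0`, its restriction to
`I_Δ` sends `c - 1` to `κ(d, c)`. -/
def κLin (d : Δ) : (Δ →₀ ℤ) →ₗ[ℤ] KerAb π := Finsupp.linearCombination ℤ (s.κ d)

/-- Left multiplication by `d` on `I_Δ`. -/
def augMul (d : Δ) : AugIdeal Δ →ₗ[ℤ] AugIdeal Δ :=
  (Finsupp.lmapDomain ℤ ℤ (d * ·)).restrict (by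
    intro x hx
    rw [LinearMap.mem_ker] at hx ⊢
    rw [Finsupp.lmapDomain_apply, Finsupp.linearCombination_mapDomain]
    exact hx)

theorem κ_cocycle (d e c : Δ) :
    conjKer π (s.rep d) (s.κ e c) + s.κ d (e * c) = s.κ d e + s.κ (d * e) c := by
  rw [κ, κ, κ, κ, conjKer_kerMk, ← kerMk_mul, ← kerMk_mul]
  congr 1
  apply Subtype.ext
  simp [MulAut.conjNormal_apply, mul_assoc]

theorem κ_one_right (d : Δ) : s.κ d 1 = 0 := by
  have : (⟨s.rep d * s.rep 1 * (s.rep (d * 1))⁻¹, by simp [MonoidHom.mem_ker, s.π_rep]⟩ : π.ker) = 1 := by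
    apply Subtype.ext
    simp [s.rep_one]
  rw [κ, this]
  rfl

theorem κ_one_left (c : Δ) : s.κ 1 c = 0 := by
  have : (⟨s.rep 1 * s.rep c * (s.rep (1 * c))⁻¹, by simp [MonoidHom.mem_ker, s.π_rep]⟩ : π.ker) = 1 := by
    apply Subtype.ext
    simp [s.rep_one]
  rw [κ, this]
  rfl

theorem conjKer_rep_mul (d e : Δ) (x : KerAb π) :
    conjKer π (s.rep d) (conjKer π (s.rep e) x) = conjKer π (s.rep (d * e)) x := by
  have h : s.rep d * s.rep e =
      s.rep d * s.rep e * (s.rep (d * e))⁻¹ * s.rep (d * e) := by simp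
  rw [← conjKer_mul, h, conjKer_mul, conjKer_of_mem]
  simp [MonoidHom.mem_ker, s.π_rep]

theorem κLin_mul (d e : Δ) (x : AugIdeal Δ) :
    conjKer π (s.rep d) (s.κLin e x.1) + s.κLin d (augMul e x).1 = s.κLin (d * e) x.1 := by
  have key : ∀ y : Δ →₀ ℤ, conjKer π (s.rep d) (s.κLin e y) +
      s.κLin d (Finsupp.mapDomain (e * ·) y) =
      Finsupp.linearCombination ℤ (fun _ : Δ => (1 : ℤ)) y • s.κ d e + s.κLin (d * e) y := by
    intro y
    induction y using Finsupp.induction_linear with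
    | zero => simp
    | add f g hf hg =>
      simp only [map_add, Finsupp.mapDomain_add, add_smul]
      rw [add_add_add_comm, hf, hg, add_add_add_comm]
    | single c n =>
      simp only [κLin, Finsupp.linearCombination_single, Finsupp.mapDomain_single, map_smul]
      rw [← smul_add, κ_cocycle, smul_add, smul_eq_mul, mul_one]
  have h := key x.1
  rw [LinearMap.mem_ker.1 x.2, zero_smul, zero_add] at h
  exact h

/-- The `ℤ[Δ]`-module `ℰ`: the group `Γ₂^ab ⊕ I_Δ` with the action of `Δ` determined by
`d ∗ (k, c - 1) = (d k d⁻¹ · κ(d, c), dc - d)`. -/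
def repE : Representation ℤ Δ (ModE π) where
  toFun d :=
    { toFun := fun x => (conjKer π (s.rep d) x.1 + s.κLin d x.2.1, augMul d x.2)
      map_add' := fun x y => by
        refine Prod.ext ?_ ?_
        · simp only [Prod.fst_add, Prod.snd_add, map_add, Submodule.coe_add]
          exact add_add_add_comm _ _ _ _
        · simp
      map_smul' := fun n x => by
        refine Prod.ext ?_ ?_
        · simp only [Prod.smul_fst, Prod.smul_snd, map_smul, SetLike.val_smul, smul_add,
            RingHom.id_apply]
        · simp }
  map_one' := by
    refine LinearMap.ext fun x => Prod.ext ?_ ?_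
    · have h1 : s.κLin 1 x.2.1 = 0 := by
        have : s.κ 1 = fun _ => 0 := funext s.κ_one_left
        simp [κLin, this, Finsupp.linearCombination_apply]
      change conjKer π (s.rep 1) x.1 + s.κLin 1 x.2.1 = x.1
      rw [h1, s.rep_one, conjKer_of_mem π 1 (one_mem _), add_zero]
    · apply Subtype.ext
      change Finsupp.mapDomain (fun c => 1 * c) x.2.1 = x.2.1
      simp only [one_mul]
      exact Finsupp.mapDomain_id
  map_mul' d e := by
    refine LinearMap.ext fun x => Prod.ext ?_ ?_
    · change conjKer π (s.rep (d * e)) x.1 + s.κLin (d * e) x.2.1 =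
        conjKer π (s.rep d) (conjKer π (s.rep e) x.1 + s.κLin e x.2.1) +
          s.κLin d (augMul e x.2).1
      rw [map_add, add_assoc, κLin_mul, conjKer_rep_mul]
    · apply Subtype.ext
      change Finsupp.mapDomain (fun c => d * e * c) x.2.1 =
        Finsupp.mapDomain (d * ·) (Finsupp.mapDomain (e * ·) x.2.1)
      rw [← Finsupp.mapDomain_comp]
      congr 1
      funext c
      exact mul_assoc _ _ _

/-- The element `(γ · γ̄⁻¹, γ - 1)` of `ℰ = Γ₂^ab ⊕ I_Δ`, where `γ̄` is the chosen
representative of the coset of `γ`. -/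
def elt (γ : Γ) : ModE π :=
  (kerMk π ⟨γ * (s.rep (π γ))⁻¹, by simp [MonoidHom.mem_ker, s.π_rep]⟩,
    ⟨Finsupp.single (π γ) 1 - Finsupp.single 1 1, by simp⟩)

variable (M : Type u) [AddCommGroup M] [DistribMulAction Δ M]

/-- The coinvariants `(ℰ ⊗ M)_Δ` for the diagonal action of `Δ`. -/
abbrev Coinv : Type u :=
  (s.repE.tprod (Representation.ofDistribMulAction ℤ Δ M)).Coinvariants

variable {M} in
/-- The universal cocycle `Φ_nat(γ)(m) = [(γ · γ̄⁻¹, γ - 1) ⊗ m] ∈ (ℰ ⊗ M)_Δ`. -/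
def natCocycle (γ : Γ) (m : M) : s.Coinv M :=
  Representation.Coinvariants.mk _ (s.elt γ ⊗ₜ[ℤ] m)

end CosetReps

end ModuleE

/-! ### Sheaves for the fpqc topology -/

section Fpqc

variable {O : Type u} [CommRing O]

/-- A functor on `O`-algebras (that is, a presheaf on affine `O`-schemes) is an fpqc sheaf if
compatible families glue uniquely along every finite jointly surjective family of flat morphisms
`Spec Bᵢ → Spec A`. -/
def IsFpqcSheaf (F : CommAlgCat.{u} O ⥤ Type u) : Prop :=
  ∀ (A : CommAlgCat.{u} O) (n : ℕ) (B : Fin n → CommAlgCat.{u} O) (f : ∀ i, A ⟶ B i),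
    (∀ i, (f i).hom.toRingHom.Flat) →
    (∀ P : PrimeSpectrum A, ∃ i, P ∈ Set.range (PrimeSpectrum.comap (f i).hom.toRingHom)) →
    ∀ x : ∀ i, F.obj (B i),
      (∀ (i j : Fin n) (C : CommAlgCat.{u} O) (g : B i ⟶ C) (h : B j ⟶ C),
        f i ≫ g = f j ≫ h → F.map g (x i) = F.map h (x j)) →
      ∃! y : F.obj A, ∀ i, F.map (f i) y = x i

/-- `η : P → F` exhibits `F` as the fpqc sheafification of the presheaf `P`. -/
def IsFpqcSheafification {P F : CommAlgCat.{u} O ⥤ Type u} (η : P ⟶ F) : Prop :=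
  IsFpqcSheaf F ∧ ∀ F' : CommAlgCat.{u} O ⥤ Type u, IsFpqcSheaf F' →
    ∀ α : P ⟶ F', ∃! β : F ⟶ F', η ≫ β = α

variable (O) in
/-- The group algebra `O[W]` of an abelian group `W`, as an object of the category of commutative
`O`-algebras. -/
abbrev grpAlg (W : Type u) [AddCommGroup W] : CommAlgCat.{u} O :=
  CommAlgCat.of O (AddMonoidAlgebra O W)

end Fpqc

/-! ### Evaluation of natural transformations at points -/

section Evaluation

namespace SplitGeneralisedTorus

variable {O M Δ H Γ : Type u} [CommRing O] [AddCommGroup M] [Group Δ] [Finite Δ]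
  [CommRing H] [HopfAlgebra O H] [Group Γ] (G : SplitGeneralisedTorus O M Δ H) {π : Γ →* Δ}

/-- The admissible representation which is the image of the cocycle `Φ` under `b`. -/
def ofCocycle [DistribMulAction Δ M] (b : z1Functor π M O ⟶ G.repFunctor π)
    (A : CommAlgCat.{u} O) (Φ : Z1 π M A) : G.Rep π A :=
  b.app A Φ

/-- The admissible representation which corresponds to a point `ψ : R → A` of a representing
object. -/
def ofPoint {R : CommAlgCat.{u} O} (c : (G.repFunctor π).CorepresentableBy R)
    (A : CommAlgCat.{u} O) (ψ : R ⟶ A) : G.Rep π A :=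
  c.homEquiv ψ

/-- The orbit of an admissible representation. -/
def orbit (A : CommAlgCat.{u} O) (ρ : G.Rep π A) : (G.orbitFunctor π).obj A :=
  Quotient.mk (MulAction.orbitRel (TorusPt M A) (G.Rep π A)) ρ

/-- The point `R → A` which is the image of the orbit of `ρ` under `q : Rep/𝔇(M) → Spec R`. -/
def quotientPoint {R : CommAlgCat.{u} O} (q : G.orbitFunctor π ⟶ coyoneda.obj (Opposite.op R))
    (A : CommAlgCat.{u} O) (ρ : G.Rep π A) : R →ₐ[O] A :=
  (q.app A (G.orbit A ρ)).hom

end SplitGeneralisedTorus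

end Evaluation

end

end GenTorus

/-!
Since `ρ₀` exists, `Φ ↦ Φ ρ₀` turns admissible representations into cocycles with values in
`Hom(M, Aˣ)`, and these are the characters of the target `(ℰ ⊗ M)_Δ` of the universal
`Hom(M, -)`-valued cocycle. The chains `C₁(Γ, M)` modulo boundaries have the same universal
property, so `d₁` descends to `∂ : (ℰ ⊗ M)_Δ → M` with kernel `H₁(Γ, M)`.

Conjugation by `t` multiplies a character by `t⁻¹ ∘ ∂`. Hence the invariants of `O[(ℰ ⊗ M)_Δ]` are
its elements of degree `0` for the grading by `∂`, that is `O[H₁(Γ, M)]`. Two representations with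
the same character of `H₁(Γ, M)` differ by a character of the image of `∂`; this extends to `M`
after the faithfully flat extension of scalars obtained from `O[im ∂] → O[M]`, so the
representations become conjugate there. As `im ∂` is free, `H₁(Γ, M)` is a direct summand and every
character of it comes from a representation.

An admissible pseudocharacter at `γ ∈ Γⁿ` only sees the component of `Gⁿ` over `(π γ₁, …, π γₙ)`.
Translation by `(ρ₀ γ₁, …, ρ₀ γₙ)` identifies it with `𝔇(Mⁿ)`, and its invariant functions with the
span of those characters `(m₁, …, mₙ)` for which `∑ mᵢ [γᵢ]` is a cycle. Compatibility with
reindexing glues the values on them to a character of the group of cycles, and compatibility with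
products makes it trivial on boundaries.
-/

namespace GenTorus

noncomputable section

open AddMonoidAlgebra (single mapDomainAlgHom)

namespace TorusPt

variable {O W V A B : Type u} [CommRing O] [AddCommGroup W] [AddCommGroup V] [CommRing A]
  [Algebra O A] [CommRing B] [Algebra O B]

theorem ext_val {s t : TorusPt W A} (h : ∀ w, s.val w = t.val w) : s = t :=
  MonoidHom.ext fun w => h w.toAdd

theorem val_add (t : TorusPt W A) (v w : W) : t.val (v + w) = t.val v * t.val w :=
  MonoidHom.map_mul (show Multiplicative W →* Aˣ from t) _ _

theorem val_zero (t : TorusPt W A) : t.val 0 = 1 :=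
  MonoidHom.map_one (show Multiplicative W →* Aˣ from t)

theorem mul_val (s t : TorusPt W A) (w : W) : (s * t).val w = s.val w * t.val w := rfl

theorem inv_val (t : TorusPt W A) (w : W) : t⁻¹.val w = (t.val w)⁻¹ := rfl

theorem map_val (f : A →ₐ[O] B) (t : TorusPt W A) (w : W) :
    ((TorusPt.map f t).val w : B) = f (t.val w) := rfl

/-- A character `W → Aˣ` as a homomorphism of additive groups, so that the lemmas on
`AddMonoidHom` apply to it. -/
def toAddHom (t : TorusPt W A) : W →+ Additive Aˣ where
  toFun w := Additive.ofMul (t.val w)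
  map_zero' := congrArg Additive.ofMul t.val_zero
  map_add' v w := congrArg Additive.ofMul (t.val_add v w)

/-- The character `W → Aˣ` given by a homomorphism of additive groups; it is inverse to
`toAddHom`. -/
def ofAddHom (f : W →+ Additive Aˣ) : TorusPt W A :=
  (show Multiplicative W →* Aˣ from AddMonoidHom.toMultiplicativeLeft f)

theorem val_sub (t : TorusPt W A) (v w : W) : t.val (v - w) = t.val v * (t.val w)⁻¹ :=
  (map_sub t.toAddHom v w).trans (sub_eq_add_neg _ _)

theorem val_finsuppSum {ι N : Type*} [Zero N] (t : TorusPt W A) (z : ι →₀ N) (f : ι → N → W) :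
    t.val (z.sum f) = z.prod fun i n => t.val (f i n) :=
  map_finsuppSum t.toAddHom z f

/-- The homomorphism `Hom(W, Aˣ) → Hom(V, Aˣ)` induced by `V → W`. -/
def comap (f : V →+ W) : TorusPt W A →* TorusPt V A where
  toFun t := ofAddHom (t.toAddHom.comp f)
  map_one' := rfl
  map_mul' _ _ := rfl

theorem comap_val (f : V →+ W) (t : TorusPt W A) (v : V) : (comap f t).val v = t.val (f v) := rfl

variable (O) in
/-- The homomorphism of algebras `O[W] → A` given by a character `W → Aˣ`. -/
def charHom (t : TorusPt W A) : AddMonoidAlgebra O W →ₐ[O] A := (TorusPt.toPt O t).ofConv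

theorem charHom_single (t : TorusPt W A) (w : W) (r : O) :
    t.charHom O (single w r) = r • (t.val w : A) :=
  AddMonoidAlgebra.lift_single (R := O) ((Units.coeHom A).comp t) w r

theorem charHom_single_one (t : TorusPt W A) (w : W) :
    t.charHom O (single w 1) = (t.val w : A) := by
  rw [charHom_single, one_smul]

theorem charHom_ext {f g : AddMonoidAlgebra O W →ₐ[O] A}
    (h : ∀ w, f (single w 1) = g (single w 1)) : f = g :=
  AddMonoidAlgebra.algHom_ext h (Subsingleton.elim _ _)

variable (O W) in
/-- The universal character `W → O[W]ˣ`. -/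
def univ : TorusPt W (AddMonoidAlgebra O W) :=
  (show Multiplicative W →* (AddMonoidAlgebra O W)ˣ from (AddMonoidAlgebra.of O W).toHomUnits)

theorem univ_val (w : W) : ((univ O W).val w : AddMonoidAlgebra O W) = single w 1 := rfl

variable (O) in
/-- Homomorphisms of algebras `O[W] → A` correspond to characters `W → Aˣ`. -/
def charEquiv : TorusPt W A ≃ (AddMonoidAlgebra O W →ₐ[O] A) where
  toFun t := t.charHom O
  invFun ψ := TorusPt.map ψ (univ O W)
  left_inv t := ext_val fun w => Units.ext <| by
    rw [map_val, univ_val, charHom_single_one]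
  right_inv ψ := charHom_ext fun w => by
    rw [charHom_single_one, map_val, univ_val]

theorem charHom_univ : (univ O W).charHom O = .id O _ :=
  charHom_ext fun w => by rw [charHom_single_one, univ_val, AlgHom.id_apply]

theorem comp_charHom (f : A →ₐ[O] B) (t : TorusPt W A) :
    f.comp (t.charHom O) = (TorusPt.map f t).charHom O :=
  charHom_ext fun w => by
    rw [AlgHom.comp_apply, charHom_single_one, charHom_single_one, map_val]

theorem mapDomainAlgHom_single (f : V →+ W) (v : V) :
    mapDomainAlgHom O O f (single v 1) = single (f v) 1 :=
  AddMonoidAlgebra.mapDomain_single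

theorem charHom_comp_mapDomain (f : V →+ W) (t : TorusPt W A) :
    (t.charHom O).comp (mapDomainAlgHom O O f) = (comap f t).charHom O :=
  charHom_ext fun w => by
    rw [AlgHom.comp_apply, mapDomainAlgHom_single, charHom_single_one, charHom_single_one,
      comap_val]

theorem charHom_comap_univ (f : V →+ W) :
    (comap f (univ O W)).charHom O = mapDomainAlgHom O O f :=
  charHom_ext fun w => by
    rw [charHom_single_one, comap_val, univ_val, mapDomainAlgHom_single]

/-- Morphisms `O[W] ⟶ A` in the category of algebras correspond to characters `W → Aˣ`. -/
def pointEquiv (A : CommAlgCat.{u} O) : (grpAlg O W ⟶ A) ≃ TorusPt W A where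
  toFun ψ := (charEquiv O).symm ψ.hom
  invFun t := CommAlgCat.ofHom (t.charHom O)
  left_inv ψ := CommAlgCat.hom_ext ((charEquiv O).apply_symm_apply ψ.hom)
  right_inv t := (charEquiv O).symm_apply_apply t

/-- The action of `Hom(W, -)` on `Hom(V, -)` through `D` is the grading of `O[V]` by `D`, so its
invariants are the elements of degree `0`. It suffices to test the universal points of
`Hom(W × V, -)`. -/
theorem map_eq_zero_of_mem_support (D : V →+ W) {x : AddMonoidAlgebra O V}
    (h : ∀ (A : Type u) [CommRing A] [Algebra O A] (t : TorusPt W A) (a : TorusPt V A),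
      (comap D t * a).charHom O x = a.charHom O x)
    {v : V} (hv : v ∈ x.coeff.support) : D v = 0 := by
  let χ := univ O (W × V)
  have hgraph : comap D (comap (.inl W V) χ) * comap (.inr W V) χ =
      comap (D.prod (.id V)) χ :=
    ext_val fun v => by
      rw [mul_val, comap_val, comap_val, comap_val, comap_val, ← val_add]
      simp
  have hx := h _ (comap (.inl W V) χ) (comap (.inr W V) χ)
  rw [hgraph, charHom_comap_univ, charHom_comap_univ] at hx
  have hinj : Function.Injective (D.prod (.id V)) := fun a b hab => congrArg Prod.snd hab
  have hmem : (D v, v) ∈ (Finsupp.mapDomain (.inr W V : V →+ W × V) x.coeff).support := by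
    rw [← AddMonoidAlgebra.coeff_mapDomain]
    change _ ∈ (mapDomainAlgHom O O (.inr W V) x).coeff.support
    rw [← hx, Finsupp.mem_support_iff]
    exact (Finsupp.mapDomain_apply hinj x.coeff v).trans_ne (Finsupp.mem_support_iff.1 hv)
  classical
  obtain ⟨v', -, hv'⟩ := Finset.mem_image.1 (Finsupp.mapDomain_support hmem)
  exact (congrArg Prod.fst hv').symm

theorem mem_range_mapDomainAlgHom_iff {N : Type u} [AddCommGroup N] {i : N →+ V} {D : V →+ W}
    (hi : Function.Injective i) (hexact : Function.Exact i D) {x : AddMonoidAlgebra O V} :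
    x ∈ (mapDomainAlgHom O O i).range ↔
      ∀ (A : Type u) [CommRing A] [Algebra O A] (t : TorusPt W A) (a : TorusPt V A),
        (comap D t * a).charHom O x = a.charHom O x := by
  constructor
  · rintro ⟨y, rfl⟩ A _ _ t a
    have hcomap : comap i (comap D t * a) = comap i a := ext_val fun v => by
      rw [comap_val, comap_val, mul_val, comap_val, hexact.apply_apply_eq_zero, val_zero, one_mul]
    change ((comap D t * a).charHom O).comp (mapDomainAlgHom O O i) y =
      (a.charHom O).comp (mapDomainAlgHom O O i) y
    rw [charHom_comp_mapDomain, charHom_comp_mapDomain, hcomap]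
  · intro h
    exact ⟨AddMonoidAlgebra.comapDomain i hi x, AddMonoidAlgebra.mapDomain_comapDomain
      (fun v hv => (hexact v).1 (map_eq_zero_of_mem_support D h hv)) hi⟩

end TorusPt

section ExtendCharacters

variable {O V W A : Type u} [CommRing O] [AddCommGroup V] [AddCommGroup W] [CommRing A]
  [Algebra O A]

/-- The decomposition of `W` into cosets of the image of an injective homomorphism `V → W`. -/
def cosetEquiv {i : V →+ W} (hi : Function.Injective i) : (W ⧸ i.range) × V ≃ W :=
  .ofBijective (fun p => i p.2 + p.1.out) <| by
    have hmk (v : V) (q : W ⧸ i.range) : (QuotientAddGroup.mk (i v + q.out) : W ⧸ i.range) = q := by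
      rw [QuotientAddGroup.mk_add,
        (QuotientAddGroup.eq_zero_iff (i v)).2 (AddMonoidHom.mem_range.2 ⟨v, rfl⟩), zero_add,
        QuotientAddGroup.out_eq']
    refine ⟨fun ⟨q, v⟩ ⟨q', v'⟩ h => ?_, fun w => ?_⟩
    · obtain rfl : q = q' := (hmk v q).symm.trans ((congrArg _ h).trans (hmk v' q'))
      exact Prod.ext rfl (hi (add_right_cancel h))
    · obtain ⟨v, hv⟩ : w - (QuotientAddGroup.mk w : W ⧸ i.range).out ∈ i.range := by
        rw [← QuotientAddGroup.eq_zero_iff, QuotientAddGroup.mk_sub, QuotientAddGroup.out_eq',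
          sub_self]
      exact ⟨(QuotientAddGroup.mk w, v), by simp only [hv, sub_add_cancel]⟩

theorem cosetEquiv_apply {i : V →+ W} (hi : Function.Injective i) (q : W ⧸ i.range) (v : V) :
    cosetEquiv hi (q, v) = i v + q.out := rfl

theorem faithfullyFlat_mapDomainAlgHom {i : V →+ W} (hi : Function.Injective i) :
    (mapDomainAlgHom O O i).toRingHom.FaithfullyFlat := by
  let : Algebra (AddMonoidAlgebra O V) (AddMonoidAlgebra O W) :=
    (mapDomainAlgHom O O i).toRingHom.toAlgebra
  let T := Finsupp.linearCombination (AddMonoidAlgebra O V)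
    fun q : W ⧸ i.range => (single q.out 1 : AddMonoidAlgebra O W)
  let e : ((W ⧸ i.range) →₀ AddMonoidAlgebra O V) ≃+ AddMonoidAlgebra O W :=
    (Finsupp.mapRange.addEquiv AddMonoidAlgebra.coeffAddEquiv).trans <|
      Finsupp.curryAddEquiv.symm.trans <|
        (Finsupp.domCongr (cosetEquiv hi)).trans AddMonoidAlgebra.coeffAddEquiv.symm
  have hT : T.toAddMonoidHom = e.toAddMonoidHom := by
    refine Finsupp.addHom_ext' fun q => AddMonoidAlgebra.addMonoidHom_ext fun v r => ?_
    calc T (Finsupp.single q (single v r))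
        = mapDomainAlgHom O O i (single v r) * single q.out 1 :=
          Finsupp.linearCombination_single ..
      _ = single (cosetEquiv hi (q, v)) r := by
          rw [cosetEquiv_apply, AddMonoidAlgebra.mapDomainAlgHom_apply,
            AddMonoidAlgebra.mapDomain_single, AddMonoidAlgebra.single_mul_single, mul_one]
      _ = e (Finsupp.single q (single v r)) := by simp [e]
  have hbij : Function.Bijective T := by
    have : ⇑T = e := congrArg DFunLike.coe hT
    exact this ▸ e.bijective
  have : Module.FaithfullyFlat (AddMonoidAlgebra O V) (AddMonoidAlgebra O W) :=
    .of_linearEquiv _ _ (LinearEquiv.ofBijective T hbij).symm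
  exact RingHom.faithfullyFlat_algebraMap_iff.2 this

namespace TorusPt

/-- `A → A ⊗_{O[V]} O[W]` is the universal extension of scalars over which `a` extends. -/
theorem exists_comap_eq_map_of_injective {i : V →+ W} (hi : Function.Injective i)
    (a : TorusPt V A) :
    ∃ (B : Type u) (_ : CommRing B) (_ : Algebra O B) (f : A →ₐ[O] B) (t : TorusPt W B),
      f.toRingHom.FaithfullyFlat ∧ comap i t = TorusPt.map f a := by
  let j := mapDomainAlgHom O O i
  let : Algebra (AddMonoidAlgebra O V) (AddMonoidAlgebra O W) := j.toRingHom.toAlgebra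
  let : Algebra (AddMonoidAlgebra O V) A := (a.charHom O).toRingHom.toAlgebra
  have : IsScalarTower O (AddMonoidAlgebra O V) (AddMonoidAlgebra O W) := .of_algHom j
  have : IsScalarTower O (AddMonoidAlgebra O V) A := .of_algHom (a.charHom O)
  have : Module.FaithfullyFlat (AddMonoidAlgebra O V) (AddMonoidAlgebra O W) :=
    RingHom.faithfullyFlat_algebraMap_iff.1 (faithfullyFlat_mapDomainAlgHom hi)
  let B := A ⊗[AddMonoidAlgebra O V] AddMonoidAlgebra O W
  let f : A →ₐ[O] B := Algebra.TensorProduct.includeLeft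
  let g : AddMonoidAlgebra O W →ₐ[O] B :=
    (Algebra.TensorProduct.includeRight (R := AddMonoidAlgebra O V)).restrictScalars O
  have hfg : g.comp j = f.comp (a.charHom O) :=
    AlgHom.ext fun x => (Algebra.TensorProduct.tmul_one_eq_one_tmul x).symm
  refine ⟨B, inferInstance, inferInstance, f, TorusPt.map g (univ O W),
    RingHom.faithfullyFlat_algebraMap_iff.2 (inferInstance : Module.FaithfullyFlat A B),
    (charEquiv O).injective ?_⟩
  calc (TorusPt.map g (comap i (univ O W))).charHom O
      = g.comp j := by rw [← comp_charHom, charHom_comap_univ]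
    _ = (TorusPt.map f a).charHom O := by rw [hfg, comp_charHom]

theorem exists_comap_eq_map (D : V →+ W) {a : TorusPt V A} (ha : ∀ v, D v = 0 → a.val v = 1) :
    ∃ (B : Type u) (_ : CommRing B) (_ : Algebra O B) (f : A →ₐ[O] B) (t : TorusPt W B),
      f.toRingHom.FaithfullyFlat ∧ comap D t = TorusPt.map f a := by
  let b : TorusPt (V ⧸ D.ker) A :=
    ofAddHom (QuotientAddGroup.lift D.ker a.toAddHom fun v hv => congrArg Additive.ofMul (ha v hv))
  obtain ⟨B, _, _, f, t, hf, ht⟩ :=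
    exists_comap_eq_map_of_injective (O := O) (QuotientAddGroup.kerLift_injective D) b
  exact ⟨B, _, _, f, t, hf, congrArg (comap (QuotientAddGroup.mk' D.ker)) ht⟩

end TorusPt

end ExtendCharacters

/-! ### The universal cocycle and group homology -/

theorem exists_leftInverse_of_exact {V W N : Type*} [AddCommGroup V] [AddCommGroup W]
    [AddCommGroup N] [Module.Free ℤ N] [Module.Finite ℤ N] {i : V →+ W} {D : W →+ N}
    (hi : Function.Injective i) (h : Function.Exact i D) : ∃ r : W →+ V, r.comp i = .id V := by
  let D' := D.toIntLinearMap.rangeRestrict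
  have hex : Function.Exact i.toIntLinearMap D' := fun y => Subtype.ext_iff.trans (h y)
  obtain ⟨σ, hσ⟩ :=
    Module.projective_lifting_property D' .id D.toIntLinearMap.surjective_rangeRestrict
  obtain ⟨-, r, hr⟩ := (hex.split_tfae'.out 0 1 rfl rfl).1 ⟨hi, σ, hσ⟩
  exact ⟨r.toAddMonoidHom, AddMonoidHom.ext fun v => LinearMap.congr_fun hr v⟩

section UniversalCocycle

variable {Γ Δ M W : Type u} [Group Γ] [Group Δ] {π : Γ →* Δ} [AddCommGroup M]
  [DistribMulAction Δ M] [AddCommGroup W]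

/-- The `1`-cocycles of `Γ` with values in `Hom(M, W)`. -/
def IsHomCocycle (π : Γ →* Δ) (f : Γ → M →+ W) : Prop :=
  ∀ γ γ' m, f (γ * γ') m = f γ m + f γ' ((π γ)⁻¹ • m)

theorem IsHomCocycle.map_one {f : Γ → M →+ W} (hf : IsHomCocycle π f) : f 1 = 0 := by
  ext m
  simpa using hf 1 1 m

/-- The element `c - 1` of the augmentation ideal. -/
def augSub (c : Δ) : AugIdeal Δ := ⟨Finsupp.single c 1 - Finsupp.single 1 1, by simp⟩

theorem sum_smul_augSub (x : AugIdeal Δ) : x.1.sum (fun c n => n • augSub c) = x := by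
  have hx : ∑ c ∈ x.1.support, x.1 c = 0 := by
    have h := LinearMap.mem_ker.1 x.2
    simpa only [Finsupp.linearCombination_apply, Finsupp.sum, smul_eq_mul, mul_one] using h
  refine Subtype.ext ?_
  calc (x.1.sum fun c n => n • augSub c).1
      = x.1.sum (fun c n => n • (augSub c).1) :=
        map_finsuppSum (AugIdeal Δ).subtype x.1 fun c n => n • augSub c
    _ = x.1.sum (fun c n => n • Finsupp.single c (1 : ℤ)) := by
        simp only [augSub, Finsupp.sum, smul_sub, Finset.sum_sub_distrib, ← Finset.sum_smul, hx,
          zero_smul, sub_zero]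
    _ = x.1 := by simp only [Finsupp.smul_single_one, Finsupp.sum_single]

theorem d₁_single (γ : Γ) (m : M) : d₁ π M (Finsupp.single γ m) = (π γ)⁻¹ • m - m :=
  Finsupp.liftAddHom_apply_single _ _ _

theorem d₂_single (γ γ' : Γ) (m : M) : d₂ π M (Finsupp.single (γ, γ') m) =
    Finsupp.single γ' ((π γ)⁻¹ • m) - Finsupp.single (γ * γ') m + Finsupp.single γ m :=
  Finsupp.liftAddHom_apply_single _ _ _

theorem d₁_d₂ (y : Γ × Γ →₀ M) : d₁ π M (d₂ π M y) = 0 := by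
  suffices (d₁ π M).comp (d₂ π M) = 0 from DFunLike.congr_fun this y
  refine Finsupp.addHom_ext fun p m => ?_
  rw [AddMonoidHom.comp_apply, d₂_single, map_add, map_sub, d₁_single, d₁_single, d₁_single,
    map_mul, mul_inv_rev, mul_smul, AddMonoidHom.zero_apply]
  abel

theorem d₂_single_eq_mapDomain (γ γ' : Γ) (m : M) :
    d₂ π M (Finsupp.single (γ, γ') m) = Finsupp.mapDomain ![γ, γ', γ * γ']
      (Finsupp.single 0 m + Finsupp.single 1 ((π γ)⁻¹ • m) - Finsupp.single 2 m) := by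
  rw [d₂_single, ← Finsupp.mapDomain.addMonoidHom_apply, map_sub, map_add]
  simp only [Finsupp.mapDomain.addMonoidHom_apply, Finsupp.mapDomain_single]
  change _ = Finsupp.single γ m + Finsupp.single γ' ((π γ)⁻¹ • m) - Finsupp.single (γ * γ') m
  abel

/-- The `1`-cocycle `γ ↦ m·[γ]` with values in `C₁(Γ, M) / B₁(Γ, M)`. -/
def chainCocycle (π : Γ →* Δ) (γ : Γ) : M →+ (Γ →₀ M) ⧸ (d₂ π M).range :=
  (QuotientAddGroup.mk' _).comp (Finsupp.singleAddHom γ)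

theorem isHomCocycle_chainCocycle : IsHomCocycle π (chainCocycle (M := M) π) := by
  intro γ γ' m
  have h : (QuotientAddGroup.mk' (d₂ π M).range) (d₂ π M (Finsupp.single (γ, γ') m)) = 0 :=
    (QuotientAddGroup.eq_zero_iff _).2 ⟨_, rfl⟩
  rw [d₂_single, map_add, map_sub, sub_add_eq_add_sub, sub_eq_zero] at h
  exact h.symm.trans (add_comm _ _)

/-- The `1`-cocycle `γ ↦ γ⁻¹ - 1` with values in `Hom(M, M)`. -/
def boundaryCocycle (π : Γ →* Δ) (γ : Γ) : M →+ M :=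
  DistribSMul.toAddMonoidHom M (π γ)⁻¹ - AddMonoidHom.id M

theorem isHomCocycle_boundaryCocycle : IsHomCocycle π (boundaryCocycle (M := M) π) := by
  intro γ γ' m
  simp [boundaryCocycle, mul_smul]

namespace CosetReps

variable (s : CosetReps π)

theorem elt_ker (k : π.ker) : s.elt k.1 = (kerMk π k, 0) := by
  have hk : π k.1 = 1 := k.2
  refine Prod.ext (congrArg (kerMk π) (Subtype.ext ?_)) (Subtype.ext ?_)
  · simp [hk, s.rep_one]
  · simp [elt, hk]

theorem elt_rep (c : Δ) : s.elt (s.rep c) = (0, augSub c) := by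
  refine Prod.ext (congrArg (kerMk π) (a₂ := 1) (Subtype.ext ?_)) (Subtype.ext ?_)
  · simp [s.π_rep]
  · simp [elt, augSub, s.π_rep]

theorem hom_ext_elt {f g : ModE π →+ W} (h : ∀ γ, f (s.elt γ) = g (s.elt γ)) : f = g := by
  refine AddMonoidHom.ext fun ⟨k, x⟩ => ?_
  have hk : f (k, 0) = g (k, 0) := by
    induction k using kerMk_induction with
    | h k => rw [← s.elt_ker, h]
  have hx : f (0, x) = g (0, x) := by
    change f.comp (.inr _ _) x = g.comp (.inr _ _) x
    rw [← sum_smul_augSub x, map_finsuppSum, map_finsuppSum]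
    refine Finsupp.sum_congr fun c _ => ?_
    rw [map_zsmul, map_zsmul, AddMonoidHom.comp_apply, AddMonoidHom.comp_apply,
      AddMonoidHom.inr_apply, ← s.elt_rep, h]
  rw [← add_zero k, ← zero_add x, ← Prod.mk_add_mk, map_add, map_add, hk, hx]

theorem κLin_augSub (d c : Δ) : s.κLin d (augSub c).1 = s.κ d c := by
  simp only [κLin, augSub, map_sub, Finsupp.linearCombination_single, one_smul, κ_one_right,
    sub_zero]

theorem augMul_augSub (d c : Δ) : augMul d (augSub c) = augSub (d * c) - augSub d := by
  refine Subtype.ext ?_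
  change Finsupp.lmapDomain ℤ ℤ (d * ·) (Finsupp.single c 1 - Finsupp.single 1 1) =
    (Finsupp.single (d * c) 1 - Finsupp.single 1 1) - (Finsupp.single d 1 - Finsupp.single 1 1)
  simp only [map_sub, Finsupp.lmapDomain_apply, Finsupp.mapDomain_single, mul_one,
    sub_sub_sub_cancel_right]

theorem elt_mul (γ γ' : Γ) : s.elt (γ * γ') = s.elt γ + s.repE (π γ) (s.elt γ') := by
  refine Prod.ext ?_ ?_
  · change kerMk π _ = kerMk π _ + (conjKer π (s.rep (π γ)) (kerMk π _) +
      s.κLin (π γ) (augSub (π γ')).1)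
    rw [κLin_augSub, conjKer_kerMk, κ, ← kerMk_mul, ← kerMk_mul]
    refine congrArg _ (Subtype.ext ?_)
    simp [MulAut.conjNormal_apply, mul_assoc]
  · change augSub (π (γ * γ')) = augSub (π γ) + augMul (π γ) (augSub (π γ'))
    rw [augMul_augSub, map_mul, add_sub_cancel]

theorem mk_repE_tmul (d : Δ) (x : ModE π) (m : M) :
    Representation.Coinvariants.mk (s.repE.tprod (Representation.ofDistribMulAction ℤ Δ M))
        (s.repE d x ⊗ₜ[ℤ] m) =
      Representation.Coinvariants.mk _ (x ⊗ₜ[ℤ] (d⁻¹ • m)) := by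
  rw [← Representation.Coinvariants.mk_self_apply _ d (x ⊗ₜ[ℤ] (d⁻¹ • m)),
    Representation.tprod_apply, TensorProduct.map_tmul,
    Representation.ofDistribMulAction_apply_apply, smul_inv_smul]

/-- The universal cocycle, as a family of homomorphisms. -/
def natHom (γ : Γ) : M →+ s.Coinv M :=
  AddMonoidHom.mk' (s.natCocycle γ) fun m m' => by
    simp only [natCocycle, TensorProduct.tmul_add, map_add]

theorem isHomCocycle_natHom : IsHomCocycle π (s.natHom (M := M)) := fun γ γ' m => by
  change s.natCocycle _ _ = s.natCocycle _ _ + s.natCocycle _ _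
  simp only [natCocycle, elt_mul, TensorProduct.add_tmul, map_add, mk_repE_tmul]

section Lift

variable {f : Γ → M →+ W} (hf : IsHomCocycle π f)

/-- The restriction of a cocycle to `Γ₂^ab`. -/
def kerLift : KerAb π →+ (M →+ W) :=
  MonoidHom.toAdditiveLeft (Abelianization.lift (G := π.ker) (A := Multiplicative (M →+ W))
    { toFun := fun k => Multiplicative.ofAdd (f k.1)
      map_one' := congrArg Multiplicative.ofAdd hf.map_one
      map_mul' := fun k l => congrArg Multiplicative.ofAdd <| AddMonoidHom.ext fun m => by
        have h := hf k.1 l.1 m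
        rwa [show π k.1 = 1 from k.2, inv_one, one_smul] at h })

/-- The extension of a cocycle to `ℰ`. -/
def eltLift : ModE π →+ (M →+ W) :=
  AddMonoidHom.coprod (kerLift hf)
    ((Finsupp.linearCombination ℤ fun c => f (s.rep c)).toAddMonoidHom.comp
      (AugIdeal Δ).subtype.toAddMonoidHom)

theorem eltLift_elt (γ : Γ) : s.eltLift hf (s.elt γ) = f γ := by
  change f (γ * (s.rep (π γ))⁻¹) + Finsupp.linearCombination ℤ (fun c => f (s.rep c))
    (Finsupp.single (π γ) 1 - Finsupp.single 1 1) = f γ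
  rw [map_sub, Finsupp.linearCombination_single, Finsupp.linearCombination_single, one_smul,
    one_smul, s.rep_one, hf.map_one, sub_zero]
  ext m
  have h := hf (γ * (s.rep (π γ))⁻¹) (s.rep (π γ)) m
  rw [inv_mul_cancel_right, map_mul, map_inv, s.π_rep, mul_inv_cancel, inv_one, one_smul] at h
  exact h.symm

theorem eltLift_repE (d : Δ) (x : ModE π) (m : M) :
    s.eltLift hf (s.repE d x) m = s.eltLift hf x (d⁻¹ • m) := by
  suffices h : (s.eltLift hf).comp (s.repE d).toAddMonoidHom =
      (DistribSMul.toAddMonoidHom M d⁻¹).compHom'.comp (s.eltLift hf) from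
    DFunLike.congr_fun (DFunLike.congr_fun h x) m
  refine s.hom_ext_elt fun γ => AddMonoidHom.ext fun m => ?_
  have hd : s.elt (s.rep d * γ) = s.elt (s.rep d) + s.repE d (s.elt γ) := by
    rw [elt_mul, s.π_rep]
  have h := congrArg (fun y => s.eltLift hf y m) hd
  simp only [map_add, eltLift_elt, AddMonoidHom.add_apply] at h
  rw [hf, s.π_rep, add_left_cancel_iff] at h
  change s.eltLift hf (s.repE d (s.elt γ)) m = s.eltLift hf (s.elt γ) (d⁻¹ • m)
  rw [← h, eltLift_elt]

/-- The homomorphism `(ℰ ⊗ M)_Δ → W` which corresponds to a cocycle with values in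
`Hom(M, W)`. -/
def coinvLift : s.Coinv M →+ W :=
  (Representation.Coinvariants.lift _
    (TensorProduct.lift (LinearMap.mk₂ ℤ (fun x m => s.eltLift hf x m)
      (fun _ _ _ => by simp) (fun _ _ _ => by simp) (fun _ _ _ => by simp)
      (fun _ _ _ => by simp)))
    (fun d => TensorProduct.ext' fun x m => by
      rw [LinearMap.comp_apply, Representation.tprod_apply, TensorProduct.map_tmul,
        TensorProduct.lift.tmul, TensorProduct.lift.tmul, LinearMap.mk₂_apply,
        LinearMap.mk₂_apply, eltLift_repE, Representation.ofDistribMulAction_apply_apply,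
        inv_smul_smul])).toAddMonoidHom

theorem coinvLift_natCocycle (γ : Γ) (m : M) : s.coinvLift hf (s.natCocycle γ m) = f γ m :=
  DFunLike.congr_fun (s.eltLift_elt hf γ) m

end Lift

theorem coinv_hom_ext {f g : s.Coinv M →+ W}
    (h : ∀ γ m, f (s.natCocycle γ m) = g (s.natCocycle γ m)) : f = g := by
  let mk := (Representation.Coinvariants.mk
    (s.repE.tprod (Representation.ofDistribMulAction ℤ Δ M))).toAddMonoidHom
  have htmul (x : ModE π) (m : M) : f (mk (x ⊗ₜ[ℤ] m)) = g (mk (x ⊗ₜ[ℤ] m)) := by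
    let mkRight : ModE π →+ s.Coinv M :=
      mk.comp ((TensorProduct.mk ℤ (ModE π) M).flip m).toAddMonoidHom
    have : f.comp mkRight = g.comp mkRight := s.hom_ext_elt fun γ => h γ m
    exact DFunLike.congr_fun this x
  refine AddMonoidHom.ext fun y => ?_
  induction y using Representation.Coinvariants.induction_on with
  | h y =>
    have : (f.comp mk).toIntLinearMap = (g.comp mk).toIntLinearMap := TensorProduct.ext' htmul
    exact LinearMap.congr_fun this y

variable (M) in
/-- The homomorphism `C₁(Γ, M) → (ℰ ⊗ M)_Δ` given by the universal cocycle. -/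
def chainHom : (Γ →₀ M) →+ s.Coinv M := Finsupp.liftAddHom s.natHom

theorem chainHom_apply (z : Γ →₀ M) : s.chainHom M z = z.sum fun γ m => s.natCocycle γ m := rfl

theorem chainHom_single (γ : Γ) (m : M) :
    s.chainHom M (Finsupp.single γ m) = s.natCocycle γ m :=
  Finsupp.liftAddHom_apply_single _ _ _

theorem chainHom_comp_d₂ : (s.chainHom M).comp (d₂ π M) = 0 := by
  refine Finsupp.addHom_ext fun ⟨γ, γ'⟩ m => ?_
  have h : s.natCocycle (γ * γ') m = s.natCocycle γ m + s.natCocycle γ' ((π γ)⁻¹ • m) :=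
    s.isHomCocycle_natHom γ γ' m
  rw [AddMonoidHom.comp_apply, d₂_single, map_add, map_sub, chainHom_single, chainHom_single,
    chainHom_single, h, AddMonoidHom.zero_apply]
  abel

theorem coinvLift_comp_chainHom :
    (s.coinvLift isHomCocycle_chainCocycle).comp (s.chainHom M) =
      QuotientAddGroup.mk' (d₂ π M).range :=
  Finsupp.addHom_ext fun γ m => by
    rw [AddMonoidHom.comp_apply, chainHom_single, coinvLift_natCocycle]
    rfl

theorem chainHom_eq_zero_iff (z : Γ →₀ M) : s.chainHom M z = 0 ↔ z ∈ (d₂ π M).range := by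
  constructor
  · intro hz
    have h := DFunLike.congr_fun s.coinvLift_comp_chainHom z
    rw [AddMonoidHom.comp_apply, hz, map_zero] at h
    exact (QuotientAddGroup.eq_zero_iff _).1 h.symm
  · rintro ⟨y, rfl⟩
    exact DFunLike.congr_fun s.chainHom_comp_d₂ y

theorem chainHom_surjective : Function.Surjective (s.chainHom M) := fun y =>
  have h : QuotientAddGroup.mk' (s.chainHom M).range = 0 := s.coinv_hom_ext fun γ m =>
    (QuotientAddGroup.eq_zero_iff _).2 ⟨_, s.chainHom_single γ m⟩
  (QuotientAddGroup.eq_zero_iff y).1 (DFunLike.congr_fun h y)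

variable (M) in
/-- The homomorphism `(ℰ ⊗ M)_Δ → M` induced by the differential `C₁(Γ, M) → C₀(Γ, M)`. -/
def boundary : s.Coinv M →+ M := s.coinvLift isHomCocycle_boundaryCocycle

theorem boundary_natCocycle (γ : Γ) (m : M) :
    s.boundary M (s.natCocycle γ m) = (π γ)⁻¹ • m - m := s.coinvLift_natCocycle _ γ m

theorem boundary_chainHom (z : Γ →₀ M) : s.boundary M (s.chainHom M z) = d₁ π M z :=
  have h : (s.boundary M).comp (s.chainHom M) = d₁ π M := Finsupp.addHom_ext fun γ m => by
    rw [AddMonoidHom.comp_apply, chainHom_single, boundary_natCocycle, d₁_single]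
  DFunLike.congr_fun h z

variable (M) in
/-- The homomorphism `φ_nat : H₁(Γ, M) → (ℰ ⊗ M)_Δ`. -/
def homologyHom : HomologyOne π M →+ s.Coinv M :=
  QuotientAddGroup.lift _ ((s.chainHom M).comp (d₁ π M).ker.subtype) fun z hz =>
    (s.chainHom_eq_zero_iff z.1).2 (AddSubgroup.mem_addSubgroupOf.1 hz)

theorem homologyHom_mk (z : (d₁ π M).ker) :
    s.homologyHom M (QuotientAddGroup.mk z) = s.chainHom M z.1 := rfl

theorem homologyHom_injective : Function.Injective (s.homologyHom M) := by
  refine (injective_iff_map_eq_zero _).2 fun y hy => ?_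
  obtain ⟨z, rfl⟩ := QuotientAddGroup.mk_surjective y
  exact (QuotientAddGroup.eq_zero_iff _).2
    (AddSubgroup.mem_addSubgroupOf.2 ((s.chainHom_eq_zero_iff z.1).1 hy))

theorem exact_homologyHom_boundary : Function.Exact (s.homologyHom M) (s.boundary M) := by
  intro x
  constructor
  · intro hx
    obtain ⟨z, rfl⟩ := s.chainHom_surjective x
    rw [boundary_chainHom] at hx
    exact ⟨QuotientAddGroup.mk ⟨z, hx⟩, rfl⟩
  · rintro ⟨y, rfl⟩
    obtain ⟨z, rfl⟩ := QuotientAddGroup.mk_surjective y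
    rw [homologyHom_mk, boundary_chainHom]
    exact z.2

end CosetReps

end UniversalCocycle

section CocyclePoints

variable {Γ Δ M A : Type u} [Group Γ] [Group Δ] {π : Γ →* Δ} [AddCommGroup M]
  [DistribMulAction Δ M] [CommRing A]

theorem isHomCocycle_of_mem_Z1 (Φ : Z1 π M A) : IsHomCocycle π fun γ => (Φ.1 γ).toAddHom :=
  fun γ γ' m => congrArg (fun t : TorusPt M A => Additive.ofMul (t.val m)) (Φ.2 γ γ')

namespace CosetReps

variable (s : CosetReps π)

/-- Characters of `(ℰ ⊗ M)_Δ` correspond to cocycles. -/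
def cocycleEquiv : TorusPt (s.Coinv M) A ≃* Z1 π M A where
  toFun t := ⟨fun γ => TorusPt.comap (s.natHom γ) t, fun γ γ' => TorusPt.ext_val fun m => by
    rw [TorusPt.mul_val, TorusPt.smul_val, TorusPt.comap_val, TorusPt.comap_val,
      TorusPt.comap_val, s.isHomCocycle_natHom, TorusPt.val_add]⟩
  invFun Φ := TorusPt.ofAddHom (s.coinvLift (isHomCocycle_of_mem_Z1 Φ))
  left_inv t := congrArg TorusPt.ofAddHom
    (s.coinv_hom_ext (g := t.toAddHom) fun γ m => s.coinvLift_natCocycle _ γ m)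
  right_inv Φ := Subtype.ext <| funext fun γ => TorusPt.ext_val fun m =>
    congrArg Additive.toMul (s.coinvLift_natCocycle (isHomCocycle_of_mem_Z1 Φ) γ m)
  map_mul' _ _ := rfl

theorem cocycleEquiv_val (t : TorusPt (s.Coinv M) A) (γ : Γ) (m : M) :
    ((s.cocycleEquiv t).1 γ).val m = t.val (s.natCocycle γ m) := rfl

theorem cocycleEquiv_symm_val_natCocycle (Φ : Z1 π M A) (γ : Γ) (m : M) :
    (s.cocycleEquiv.symm Φ).val (s.natCocycle γ m) = (Φ.1 γ).val m := by
  rw [← cocycleEquiv_val, MulEquiv.apply_symm_apply]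

theorem cocycleEquiv_symm_val_chainHom (Φ : Z1 π M A) (z : Γ →₀ M) :
    (s.cocycleEquiv.symm Φ).val (s.chainHom M z) = z.prod fun γ m => (Φ.1 γ).val m := by
  rw [chainHom_apply, TorusPt.val_finsuppSum]
  simp only [cocycleEquiv_symm_val_natCocycle]

theorem cocycleEquiv_symm_coboundary (t : TorusPt M A) :
    s.cocycleEquiv.symm (coboundary π t) = TorusPt.comap (s.boundary M) t⁻¹ := by
  rw [MulEquiv.symm_apply_eq]
  refine Subtype.ext <| funext fun γ => TorusPt.ext_val fun m => ?_
  rw [cocycleEquiv_val, TorusPt.comap_val, TorusPt.inv_val, boundary_natCocycle, TorusPt.val_sub,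
    mul_inv, inv_inv, mul_comm]
  rfl

end CosetReps

end CocyclePoints

/-! ### Fpqc descent -/

section FpqcDescent

theorem faithfullyFlat_pi {ι : Type*} [Finite ι] {A : Type u} [CommRing A] {B : ι → Type u}
    [∀ i, CommRing (B i)] [∀ i, Algebra A (B i)] (hflat : ∀ i, Module.Flat A (B i))
    (hsurj : ∀ P : PrimeSpectrum A,
      ∃ i, P ∈ Set.range (PrimeSpectrum.comap (algebraMap A (B i)))) :
    Module.FaithfullyFlat A (∀ i, B i) := by
  classical
  have := Fintype.ofFinite ι
  have : Module.Flat A (∀ i, B i) :=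
    Module.Flat.of_linearEquiv (DFinsupp.linearEquivFunOnFintype (R := A) (M := B)).symm
  refine Module.FaithfullyFlat.of_comap_surjective fun P => ?_
  obtain ⟨i, Q, hQ⟩ := hsurj P
  exact ⟨PrimeSpectrum.comap (Pi.evalRingHom B i) Q, hQ⟩

theorem exists_algebraMap_eq_of_pi {ι : Type*} [Finite ι] {A : Type u} [CommRing A]
    {B : ι → Type u} [∀ i, CommRing (B i)] [∀ i, Algebra A (B i)]
    [Module.FaithfullyFlat A (∀ i, B i)] (x : ∀ i, B i)
    (hx : ∀ i j, x i ⊗ₜ[A] (1 : B j) = (1 : B i) ⊗ₜ[A] x j) :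
    ∃ a : A, algebraMap A (∀ i, B i) a = x := by
  classical
  have := Fintype.ofFinite ι
  refine (Algebra.IsEffective.of_faithfullyFlat A (∀ i, B i) x).1 ?_
  rw [Algebra.TensorProduct.includeLeftSubRight_apply, sub_eq_zero]
  have tmul_eq_sum (y z : ∀ i, B i) : y ⊗ₜ[A] z = ∑ i, ∑ j,
      TensorProduct.map (LinearMap.single A B i) (LinearMap.single A B j) (y i ⊗ₜ[A] z j) := by
    simp only [TensorProduct.map_tmul, LinearMap.single_apply, ← TensorProduct.tmul_sum,
      ← TensorProduct.sum_tmul, Finset.univ_sum_single]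
  rw [tmul_eq_sum x 1, tmul_eq_sum 1 x]
  simp only [Pi.one_apply, hx]

variable {O : Type u} [CommRing O]

theorem existsUnique_toAlgHom_comp_eq {R A C : Type u} [CommRing R] [CommRing A] [CommRing C]
    [Algebra O R] [Algebra O A] [Algebra O C] [Algebra A C] [IsScalarTower O A C]
    (hinj : Function.Injective (algebraMap A C)) (X : R →ₐ[O] C)
    (hX : ∀ r, ∃ a, algebraMap A C a = X r) :
    ∃! y : R →ₐ[O] A, (IsScalarTower.toAlgHom O A C).comp y = X := by
  let F := IsScalarTower.toAlgHom O A C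
  let y := (AlgEquiv.ofInjective F hinj).symm.toAlgHom.comp (X.codRestrict F.range hX)
  have hy (r : R) : F (y r) = X r :=
    congrArg Subtype.val ((AlgEquiv.ofInjective F hinj).apply_symm_apply _)
  exact ⟨y, AlgHom.ext hy, fun y' hy' =>
    AlgHom.ext fun r => hinj ((DFunLike.congr_fun hy' r).trans (hy r).symm)⟩

theorem isFpqcSheaf_coyoneda (R : CommAlgCat.{u} O) :
    IsFpqcSheaf (coyoneda.obj (Opposite.op R)) := by
  intro A n B f hflat hsurj x hx
  let (i : Fin n) : Algebra A (B i) := (f i).hom.toRingHom.toAlgebra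
  have (i : Fin n) : IsScalarTower O A (B i) := .of_algHom (f i).hom
  have : Module.FaithfullyFlat A (∀ i, B i) := faithfullyFlat_pi (fun i => hflat i) hsurj
  let X : R →ₐ[O] (∀ i, B i) := AlgHom.pi fun i => (x i : R ⟶ B i).hom
  have hX (r : R) (i j : Fin n) : X r i ⊗ₜ[A] (1 : B j) = (1 : B i) ⊗ₜ[A] X r j := by
    let g : B i ⟶ CommAlgCat.of O (B i ⊗[A] B j) := CommAlgCat.ofHom
      ((Algebra.TensorProduct.includeLeft : B i →ₐ[A] B i ⊗[A] B j).restrictScalars O)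
    let h : B j ⟶ CommAlgCat.of O (B i ⊗[A] B j) := CommAlgCat.ofHom
      ((Algebra.TensorProduct.includeRight : B j →ₐ[A] B i ⊗[A] B j).restrictScalars O)
    have hgh : f i ≫ g = f j ≫ h := CommAlgCat.hom_ext <| AlgHom.ext fun a =>
      Algebra.TensorProduct.tmul_one_eq_one_tmul a
    exact congrArg (fun k : R ⟶ _ => k.hom r) (hx i j _ g h hgh)
  obtain ⟨y, hy, hunique⟩ := existsUnique_toAlgHom_comp_eq (FaithfulSMul.algebraMap_injective A _) X
    fun r => exists_algebraMap_eq_of_pi (X r) (hX r)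
  refine ⟨CommAlgCat.ofHom y, fun i => CommAlgCat.hom_ext <| AlgHom.ext fun r =>
    congrFun (DFunLike.congr_fun hy r) i, fun y' hy' => CommAlgCat.hom_ext (hunique _ ?_)⟩
  exact AlgHom.ext fun r => funext fun i => congrArg (fun k : R ⟶ B i => k.hom r) (hy' i)

variable {P F : CommAlgCat.{u} O ⥤ Type u}

theorem IsFpqcSheaf.eq_of_faithfullyFlat (hF : IsFpqcSheaf F) {A B : CommAlgCat.{u} O}
    (f : A ⟶ B) (hf : f.hom.toRingHom.FaithfullyFlat) {y z : F.obj A}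
    (h : F.map f y = F.map f z) : y = z := by
  have hs := RingHom.FaithfullyFlat.iff_flat_and_comap_surjective.1 hf
  obtain ⟨w, -, hw⟩ := hF A 1 (fun _ => B) (fun _ => f) (fun _ => hs.1) (fun P => ⟨0, hs.2 P⟩)
    (fun _ => F.map f y) (fun _ _ C g h hgh => by
      simp only [← CategoryTheory.comp_apply, ← F.map_comp, hgh])
  exact (hw y fun _ => rfl).trans (hw z fun _ => h.symm).symm

theorem isFpqcSheafification_of_surjective {η : P ⟶ F} (hF : IsFpqcSheaf F)
    (hsurj : ∀ A, Function.Surjective (η.app A))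
    (hlocal : ∀ (A : CommAlgCat.{u} O) (x y : P.obj A), η.app A x = η.app A y →
      ∃ (B : CommAlgCat.{u} O) (f : A ⟶ B), f.hom.toRingHom.FaithfullyFlat ∧
        P.map f x = P.map f y) :
    IsFpqcSheafification η := by
  refine ⟨hF, fun F' hF' α => ?_⟩
  have hα {A : CommAlgCat.{u} O} {x y : P.obj A} (h : η.app A x = η.app A y) :
      α.app A x = α.app A y := by
    obtain ⟨B, f, hf, hxy⟩ := hlocal A x y h
    refine hF'.eq_of_faithfullyFlat f hf ?_
    rw [← NatTrans.naturality_apply, ← NatTrans.naturality_apply, hxy]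
  let lift (A : CommAlgCat.{u} O) := Function.surjInv (hsurj A)
  have hlift (A : CommAlgCat.{u} O) (y : F.obj A) : η.app A (lift A y) = y :=
    Function.surjInv_eq (hsurj A) y
  let β : F ⟶ F' :=
    { app := fun A => TypeCat.ofHom fun y => α.app A (lift A y)
      naturality := fun A B f => by
        ext y
        change α.app B (lift B (F.map f y)) = F'.map f (α.app A (lift A y))
        rw [← NatTrans.naturality_apply]
        refine hα ?_
        rw [hlift, NatTrans.naturality_apply, hlift] }
  refine ⟨β, ?_, fun β' hβ' => ?_⟩
  · ext A x
    exact hα (hlift A _)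
  · ext A y
    change β'.app A y = α.app A (lift A y)
    rw [← hβ', NatTrans.comp_app, CategoryTheory.comp_apply, hlift]

end FpqcDescent

/-! ### Admissible representations -/

namespace SplitGeneralisedTorus

variable {O M Δ H Γ A B : Type u} [CommRing O] [AddCommGroup M] [Group Δ] [Finite Δ]
  [CommRing H] [HopfAlgebra O H] [Group Γ] {G : SplitGeneralisedTorus O M Δ H} {π : Γ →* Δ}
  [CommRing A] [Algebra O A] [CommRing B] [Algebra O B]

theorem ι_injective : Function.Injective (G.ι A) := G.incl_injective A

theorem exists_ι_eq {g : Pt O H A} (hg : G.Proj A g = 1) : ∃ t, G.ι A t = g := by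
  have hmem : g ∈ identityComponent O H A := (G.proj_eq_one_iff A g).1 hg
  rwa [← G.range_incl A] at hmem

/-- The extension of scalars `Γ → G(A)` of a representation over `O`. -/
def baseHom (ρ₀ : G.Rep π O) (A : Type u) [CommRing A] [Algebra O A] : Γ →* Pt O H A :=
  (Pt.map H (Algebra.ofId O A)).comp ρ₀.1

theorem Proj_baseHom (ρ₀ : G.Rep π O) (γ : Γ) :
    G.Proj A (baseHom ρ₀ A γ) = constPt O A (π γ) := (Rep.map G (Algebra.ofId O A) ρ₀).2 γ

theorem map_baseHom (ρ₀ : G.Rep π O) (f : A →ₐ[O] B) (γ : Γ) :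
    Pt.map H f (baseHom ρ₀ A γ) = baseHom ρ₀ B γ :=
  ofConv_injective <| AlgHom.ext fun _ => f.commutes _

variable [DistribMulAction Δ M] (hG : G.IsConjugationAction) (ρ₀ : G.Rep π O)

include hG

theorem baseHom_mul_ι (γ : Γ) (t : TorusPt M A) :
    baseHom ρ₀ A γ * G.ι A t = G.ι A (π γ • t) * baseHom ρ₀ A γ := by
  rw [← hG A (baseHom ρ₀ A γ) (π γ) (Proj_baseHom ρ₀ γ) t, inv_mul_cancel_right]

theorem ι_mul_baseHom_mul (t t' : TorusPt M A) (γ γ' : Γ) :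
    (G.ι A t * baseHom ρ₀ A γ) * (G.ι A t' * baseHom ρ₀ A γ') =
      G.ι A (t * π γ • t') * baseHom ρ₀ A (γ * γ') := by
  rw [map_mul, map_mul, mul_assoc, ← mul_assoc (baseHom ρ₀ A γ), baseHom_mul_ι hG, mul_assoc,
    mul_assoc]

theorem conj_ι_mul_baseHom (h t : TorusPt M A) (γ : Γ) :
    G.ι A h * (G.ι A t * baseHom ρ₀ A γ) * (G.ι A h)⁻¹ =
      G.ι A (h * (π γ • h)⁻¹ * t) * baseHom ρ₀ A γ := by
  rw [← map_inv, mul_assoc, mul_assoc, baseHom_mul_ι hG, ← mul_assoc, ← mul_assoc, ← map_mul,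
    ← map_mul, smul_inv', mul_right_comm]

/-- The admissible representation `Φ ρ₀` attached to a cocycle `Φ`. -/
def twist (Φ : Z1 π M A) : G.Rep π A :=
  ⟨MonoidHom.mk' (fun γ => G.ι A (Φ.1 γ) * baseHom ρ₀ A γ) fun γ γ' => by
      rw [Φ.2 γ γ', ι_mul_baseHom_mul hG],
    fun γ => by rw [MonoidHom.mk'_apply, map_mul, Proj_ι, one_mul, Proj_baseHom]⟩

theorem twist_injective : Function.Injective (twist hG ρ₀ (A := A)) := fun _ _ h =>
  Subtype.ext <| funext fun γ =>
    ι_injective <| mul_right_cancel (DFunLike.congr_fun (congrArg Subtype.val h) γ)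

theorem twist_surjective : Function.Surjective (twist hG ρ₀ (A := A)) := by
  rintro ⟨ρ, hρ⟩
  have exists_quotient (γ : Γ) : ∃ t, G.ι A t = ρ γ * (baseHom ρ₀ A γ)⁻¹ := exists_ι_eq <| by
    rw [map_mul, map_inv, hρ, Proj_baseHom, mul_inv_cancel]
  choose Φ hΦ using exists_quotient
  have hρΦ (γ : Γ) : ρ γ = G.ι A (Φ γ) * baseHom ρ₀ A γ := by rw [hΦ, inv_mul_cancel_right]
  have hcocycle (γ γ' : Γ) : Φ (γ * γ') = Φ γ * π γ • Φ γ' := by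
    have h := ρ.map_mul γ γ'
    rw [hρΦ, hρΦ, hρΦ, ι_mul_baseHom_mul hG] at h
    exact ι_injective (mul_right_cancel h)
  exact ⟨⟨Φ, hcocycle⟩, Subtype.ext <| MonoidHom.ext fun γ => (hρΦ γ).symm⟩

/-- The bijection `Φ ↦ Φ ρ₀` between cocycles and admissible representations. -/
def twistEquiv (A : Type u) [CommRing A] [Algebra O A] : Z1 π M A ≃ G.Rep π A :=
  Equiv.ofBijective (twist hG ρ₀) ⟨twist_injective hG ρ₀, twist_surjective hG ρ₀⟩

theorem map_twistEquiv (f : A →ₐ[O] B) (Φ : Z1 π M A) :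
    Rep.map G f (twistEquiv hG ρ₀ A Φ) = twistEquiv hG ρ₀ B (Z1.map π f Φ) := by
  refine Subtype.ext <| MonoidHom.ext fun γ => ?_
  change Pt.map H f (G.ι A (Φ.1 γ) * baseHom ρ₀ A γ) =
    G.ι B (TorusPt.map f (Φ.1 γ)) * baseHom ρ₀ B γ
  rw [map_mul, map_baseHom, ← ι_map]

theorem twistEquiv_coboundary_mul (t : TorusPt M A) (Φ : Z1 π M A) :
    twistEquiv hG ρ₀ A (coboundary π t * Φ) = t • twistEquiv hG ρ₀ A Φ :=
  Subtype.ext <| MonoidHom.ext fun γ => (conj_ι_mul_baseHom hG ρ₀ t (Φ.1 γ) γ).symm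

/-- The natural bijection between `Z¹` and the set of admissible representations. -/
def twistIso : z1Functor π M O ≅ G.repFunctor π :=
  NatIso.ofComponents (fun A => (twistEquiv hG ρ₀ A).toIso) fun f => by
    ext Φ
    exact (map_twistEquiv hG ρ₀ f.hom Φ).symm

theorem twistEquiv_mem_orbit_iff (Φ Ψ : Z1 π M A) :
    twistEquiv hG ρ₀ A Φ ∈ MulAction.orbit (TorusPt M A) (twistEquiv hG ρ₀ A Ψ) ↔
      Φ⁻¹ * Ψ ∈ B1 π M A := by
  rw [← inv_mem_iff, mul_inv_rev, inv_inv, mul_comm]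
  refine exists_congr fun t => ?_
  rw [eq_mul_inv_iff_mul_eq]
  change t • _ = _ ↔ _
  rw [← twistEquiv_coboundary_mul, (twistEquiv hG ρ₀ A).apply_eq_iff_eq]

/-- The bijection between `H¹` and the set of orbits of admissible representations. -/
def orbitEquiv (A : Type u) [CommRing A] [Algebra O A] :
    H1 π M A ≃ MulAction.orbitRel.Quotient (TorusPt M A) (G.Rep π A) :=
  Quotient.congr (twistEquiv hG ρ₀ A) fun Φ Ψ =>
    QuotientGroup.leftRel_apply.trans (twistEquiv_mem_orbit_iff hG ρ₀ Φ Ψ).symm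

/-- The bijection between `H¹` and orbits as an isomorphism of functors. -/
def orbitIso : h1Functor π M O ≅ G.orbitFunctor π :=
  NatIso.ofComponents (fun A => (orbitEquiv hG ρ₀ A).toIso) fun f => by
    ext x
    induction x using QuotientGroup.induction_on with
    | H Φ => exact congrArg (Quotient.mk _) (map_twistEquiv hG ρ₀ f.hom Φ).symm

variable (s : CosetReps π)

/-- The bijection between characters of `(ℰ ⊗ M)_Δ` and admissible representations. -/
def charRepEquiv (A : Type u) [CommRing A] [Algebra O A] : TorusPt (s.Coinv M) A ≃ G.Rep π A :=
  s.cocycleEquiv.toEquiv.trans (twistEquiv hG ρ₀ A)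

theorem map_charRepEquiv (f : A →ₐ[O] B) (a : TorusPt (s.Coinv M) A) :
    Rep.map G f (charRepEquiv hG ρ₀ s A a) = charRepEquiv hG ρ₀ s B (TorusPt.map f a) :=
  map_twistEquiv hG ρ₀ f _

theorem charRepEquiv_comap_boundary_mul (t : TorusPt M A) (a : TorusPt (s.Coinv M) A) :
    charRepEquiv hG ρ₀ s A (TorusPt.comap (s.boundary M) t⁻¹ * a) =
      t • charRepEquiv hG ρ₀ s A a := by
  change twistEquiv hG ρ₀ A (s.cocycleEquiv _) = t • twistEquiv hG ρ₀ A (s.cocycleEquiv a)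
  rw [map_mul, ← s.cocycleEquiv_symm_coboundary, MulEquiv.apply_symm_apply,
    twistEquiv_coboundary_mul]

/-- The functor of admissible representations is represented by `O[(ℰ ⊗ M)_Δ]`. -/
def repCorepresentableBy : (G.repFunctor π).CorepresentableBy (grpAlg O (s.Coinv M)) where
  homEquiv {A} := (TorusPt.pointEquiv A).trans (charRepEquiv hG ρ₀ s A)
  homEquiv_comp g f :=
    (map_charRepEquiv hG ρ₀ s g.hom ((TorusPt.charEquiv O).symm f.hom)).symm

theorem repCorepresentableBy_homEquiv_symm {A : CommAlgCat.{u} O} (a : TorusPt (s.Coinv M) A) :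
    ((repCorepresentableBy hG ρ₀ s).homEquiv.symm (charRepEquiv hG ρ₀ s A a)).hom =
      a.charHom O :=
  congrArg (TorusPt.charHom O) ((charRepEquiv hG ρ₀ s A).symm_apply_apply a)

theorem range_mapDomain_homologyHom :
    (mapDomainAlgHom O O (s.homologyHom M)).range =
      G.repInvariants π (repCorepresentableBy hG ρ₀ s) := by
  ext x
  rw [TorusPt.mem_range_mapDomainAlgHom_iff (s.homologyHom_injective (M := M))
    s.exact_homologyHom_boundary]
  have invariant_iff {A : CommAlgCat.{u} O} (t : TorusPt M A) (a : TorusPt (s.Coinv M) A) :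
      ((repCorepresentableBy hG ρ₀ s).homEquiv.symm (t • charRepEquiv hG ρ₀ s A a)).hom x =
        ((repCorepresentableBy hG ρ₀ s).homEquiv.symm (charRepEquiv hG ρ₀ s A a)).hom x ↔
      (TorusPt.comap (s.boundary M) t⁻¹ * a).charHom O x = a.charHom O x := by
    rw [← charRepEquiv_comap_boundary_mul, repCorepresentableBy_homEquiv_symm,
      repCorepresentableBy_homEquiv_symm]
  constructor
  · intro hx A t ρ
    obtain ⟨a, rfl⟩ := (charRepEquiv hG ρ₀ s A).surjective ρ
    exact (invariant_iff t a).2 (hx A t⁻¹ a)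
  · intro hx A _ _ t a
    simpa only [inv_inv] using (invariant_iff (A := .of O A) t⁻¹ a).1 (hx (.of O A) t⁻¹ _)

/-- The character of `H₁(Γ, M)` attached to an admissible representation; it is a complete
invariant of conjugacy up to faithfully flat base change. -/
def homologyChar (ρ : G.Rep π A) : TorusPt (HomologyOne π M) A :=
  TorusPt.comap (s.homologyHom M) ((charRepEquiv hG ρ₀ s A).symm ρ)

theorem homologyChar_charRepEquiv (a : TorusPt (s.Coinv M) A) :
    homologyChar hG ρ₀ s (charRepEquiv hG ρ₀ s A a) = TorusPt.comap (s.homologyHom M) a :=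
  congrArg _ ((charRepEquiv hG ρ₀ s A).symm_apply_apply a)

theorem homologyChar_twistEquiv_mk (Φ : Z1 π M A) (z : (d₁ π M).ker) :
    (homologyChar hG ρ₀ s (twistEquiv hG ρ₀ A Φ)).val (QuotientAddGroup.mk z) =
      z.1.prod fun γ m => (Φ.1 γ).val m := by
  rw [← s.cocycleEquiv_symm_val_chainHom, ← s.homologyHom_mk, ← TorusPt.comap_val,
    ← homologyChar_charRepEquiv hG ρ₀]
  congr 2
  exact congrArg (twistEquiv hG ρ₀ A) (s.cocycleEquiv.apply_symm_apply Φ).symm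

theorem homologyChar_smul (t : TorusPt M A) (ρ : G.Rep π A) :
    homologyChar hG ρ₀ s (t • ρ) = homologyChar hG ρ₀ s ρ := by
  obtain ⟨a, rfl⟩ := (charRepEquiv hG ρ₀ s A).surjective ρ
  refine TorusPt.ext_val fun y => ?_
  rw [← charRepEquiv_comap_boundary_mul, homologyChar_charRepEquiv, homologyChar_charRepEquiv,
    TorusPt.comap_val, TorusPt.comap_val, TorusPt.mul_val, TorusPt.comap_val,
    s.exact_homologyHom_boundary.apply_apply_eq_zero, TorusPt.val_zero, one_mul]

theorem homologyChar_map (f : A →ₐ[O] B) (ρ : G.Rep π A) :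
    homologyChar hG ρ₀ s (Rep.map G f ρ) = TorusPt.map f (homologyChar hG ρ₀ s ρ) := by
  obtain ⟨a, rfl⟩ := (charRepEquiv hG ρ₀ s A).surjective ρ
  rw [map_charRepEquiv, homologyChar_charRepEquiv, homologyChar_charRepEquiv]
  rfl

theorem homologyChar_surjective :
    Function.Surjective (homologyChar hG ρ₀ s : G.Rep π A → TorusPt (HomologyOne π M) A) := by
  have := G.free
  have := G.finite
  obtain ⟨r, hr⟩ :=
    exists_leftInverse_of_exact (s.homologyHom_injective (M := M)) s.exact_homologyHom_boundary
  intro t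
  refine ⟨charRepEquiv hG ρ₀ s A (TorusPt.comap r t), TorusPt.ext_val fun y => ?_⟩
  rw [homologyChar_charRepEquiv, TorusPt.comap_val, TorusPt.comap_val]
  exact congrArg t.val (DFunLike.congr_fun hr y)

theorem exists_smul_eq_of_homologyChar_eq {ρ σ : G.Rep π A}
    (h : homologyChar hG ρ₀ s ρ = homologyChar hG ρ₀ s σ) :
    ∃ (B : Type u) (_ : CommRing B) (_ : Algebra O B) (f : A →ₐ[O] B) (t : TorusPt M B),
      f.toRingHom.FaithfullyFlat ∧ t • Rep.map G f ρ = Rep.map G f σ := by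
  obtain ⟨a, rfl⟩ := (charRepEquiv hG ρ₀ s A).surjective ρ
  obtain ⟨b, rfl⟩ := (charRepEquiv hG ρ₀ s A).surjective σ
  rw [homologyChar_charRepEquiv, homologyChar_charRepEquiv] at h
  have hker (v : s.Coinv M) (hv : s.boundary M v = 0) : (b * a⁻¹).val v = 1 := by
    obtain ⟨y, rfl⟩ := (s.exact_homologyHom_boundary v).1 hv
    rw [TorusPt.mul_val, TorusPt.inv_val, mul_inv_eq_one]
    exact (congrArg (fun c => TorusPt.val c y) h).symm
  obtain ⟨B, _, _, f, t, hf, ht⟩ := TorusPt.exists_comap_eq_map (O := O) (s.boundary M) hker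
  refine ⟨B, _, _, f, t⁻¹, hf, ?_⟩
  rw [map_charRepEquiv, map_charRepEquiv, ← charRepEquiv_comap_boundary_mul, inv_inv, ht, ← map_mul,
    inv_mul_cancel_right]

/-- The natural map from the presheaf of orbits to `Spec O[H₁(Γ, M)]`. -/
def quotientMap : G.orbitFunctor π ⟶
    coyoneda.obj (Opposite.op (grpAlg O (HomologyOne π M))) where
  app A := TypeCat.ofHom fun x : MulAction.orbitRel.Quotient (TorusPt M A) (G.Rep π A) =>
    (TorusPt.pointEquiv A).symm <| Quotient.lift (homologyChar hG ρ₀ s)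
      (by rintro _ ρ ⟨t, rfl⟩; exact homologyChar_smul hG ρ₀ s t ρ) x
  naturality A B f := by
    ext x
    induction x using Quotient.inductionOn with
    | h ρ =>
      refine CommAlgCat.hom_ext ?_
      change (homologyChar hG ρ₀ s (Rep.map G f.hom ρ)).charHom O = _
      rw [homologyChar_map, ← TorusPt.comp_charHom]
      rfl

theorem quotientPoint_quotientMap_twistEquiv (A : CommAlgCat.{u} O) (Φ : Z1 π M A)
    (z : (d₁ π M).ker) :
    G.quotientPoint (quotientMap hG ρ₀ s) A (twistEquiv hG ρ₀ A Φ)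
        (single (QuotientAddGroup.mk z) 1) = (z.1.prod fun γ m => (Φ.1 γ).val m : Aˣ) :=
  (TorusPt.charHom_single_one _ _).trans
    (congrArg Units.val (homologyChar_twistEquiv_mk hG ρ₀ s Φ z))

theorem isFpqcSheafification_quotientMap : IsFpqcSheafification (quotientMap hG ρ₀ s) := by
  refine isFpqcSheafification_of_surjective (isFpqcSheaf_coyoneda _) (fun A ψ => ?_)
    fun A x y hxy => ?_
  · obtain ⟨ρ, hρ⟩ := homologyChar_surjective hG ρ₀ s (TorusPt.pointEquiv A ψ)
    exact ⟨G.orbit A ρ, (TorusPt.pointEquiv A).symm_apply_eq.2 hρ⟩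
  · induction x, y using Quotient.inductionOn₂ with
    | h ρ σ =>
      obtain ⟨B, _, _, f, t, hf, ht⟩ := exists_smul_eq_of_homologyChar_eq hG ρ₀ s
        ((TorusPt.pointEquiv A).symm.injective hxy)
      exact ⟨.of O B, CommAlgCat.ofHom f, hf,
        (Quotient.sound (show _ ∈ MulAction.orbit _ _ from ⟨t, ht⟩)).symm⟩

end SplitGeneralisedTorus

/-! ### Functions on the components of `Gⁿ` -/

theorem mk_eq_mk_iff_of_isIdempotentElem {R : Type*} [CommRing R] {ε : R}
    (hε : IsIdempotentElem ε) {a b : R} :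
    Ideal.Quotient.mk (Ideal.span {1 - ε}) a = Ideal.Quotient.mk (Ideal.span {1 - ε}) b ↔
      ε * a = ε * b := by
  rw [Ideal.Quotient.eq, ← hε.ker_toSpanSingleton_eq_span, LinearMap.mem_ker,
    LinearMap.toSpanSingleton_apply, smul_eq_mul, sub_mul, sub_eq_zero, mul_comm a, mul_comm b]

theorem mk_span_one_sub {R : Type*} [CommRing R] (ε : R) :
    Ideal.Quotient.mk (Ideal.span {1 - ε}) ε = 1 :=
  (Ideal.Quotient.eq.2 (Ideal.mem_span_singleton_self _)).symm.trans (map_one _)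

section Points

variable {O H A : Type u} [CommRing O] [CommRing H] [HopfAlgebra O H] [CommRing A] [Algebra O A]

theorem mem_basicOpen_fibrePt {K : Type u} [Field K] [Algebra O K] (x : Pt O H K) (e : H) :
    fibrePt x ∈ PrimeSpectrum.basicOpen ((1 : K) ⊗ₜ[O] e) ↔ x.ofConv e ≠ 0 := by
  rw [PrimeSpectrum.mem_basicOpen]
  change ¬ Algebra.TensorProduct.lift (AlgHom.id O K) x.ofConv (fun _ _ => Commute.all _ _)
    ((1 : K) ⊗ₜ[O] e) = 0 ↔ _
  rw [Algebra.TensorProduct.lift_tmul, map_one, one_mul]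

theorem apply_eq_one_of_mem_identityComponent {e : H} (he : IsIdempotentElem e)
    (he₁ : Coalgebra.counit (R := O) e = 1) {h : Pt O H A} (hh : h ∈ identityComponent O H A) :
    h.ofConv e = 1 := by
  refine (IsIdempotentElem.iff_eq_one_of_isUnit ?_).1 (he.map h.ofConv)
  by_contra hn
  obtain ⟨m, hm, hem⟩ := exists_max_ideal_of_mem_nonunits hn
  let := Ideal.Quotient.field m
  let K := AlgebraicClosure (A ⧸ m)
  let φ : A →ₐ[O] K := (IsScalarTower.toAlgHom O (A ⧸ m) K).comp (Ideal.Quotient.mkₐ O m)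
  have hclopen : IsClopen (PrimeSpectrum.basicOpen ((1 : K) ⊗ₜ[O] e)).carrier := by
    refine PrimeSpectrum.isClopen_iff.2 ⟨_, ?_, rfl⟩
    rw [IsIdempotentElem, Algebra.TensorProduct.tmul_mul_tmul, one_mul, he]
  have hone : fibrePt (1 : Pt O H K) ∈ PrimeSpectrum.basicOpen ((1 : K) ⊗ₜ[O] e) := by
    rw [mem_basicOpen_fibrePt]
    change algebraMap O K (Coalgebra.counit e) ≠ 0
    rw [he₁, map_one]
    exact one_ne_zero
  refine (mem_basicOpen_fibrePt _ _).1 (hclopen.connectedComponent_subset hone (hh K φ)) ?_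
  change algebraMap (A ⧸ m) K (Ideal.Quotient.mk m (h.ofConv e)) = 0
  rw [Ideal.Quotient.eq_zero_iff_mem.2 hem, map_zero]

theorem evalAt_coordPt (n : ℕ) : evalAt (coordPt O H n) = AlgHom.id O (CoordPow O H n) := by
  apply AlgHom.toLinearMap_injective
  apply PiTensorProduct.ext
  ext x
  change evalAt (coordPt O H n) (PiTensorProduct.tprod O x) = PiTensorProduct.tprod O x
  rw [evalAt_tprod]
  change ∏ i, PiTensorProduct.tprodMonoidHom O (Pi.mulSingle i (x i)) = _
  rw [← map_prod, Finset.univ_prod_mulSingle]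
  rfl

theorem evalAt_pullback {H' : Type u} [CommRing H'] [HopfAlgebra O H'] (φ : H' →ₐc[O] H) {n : ℕ}
    (f : invariants O H' n) (g : Fin n → Pt O H A) :
    evalAt g (pullback φ n f).1 = evalAt (fun i => Pt.push φ (g i)) f.1 := by
  change evalAt g (evalAt (fun i => Pt.push φ (coordPt O H n i)) f.1) = _
  rw [← AlgHom.comp_apply, algHom_comp_evalAt]
  congr 2
  ext1 i
  exact congrArg (Pt.push φ) (map_evalAt_coordPt g i)

end Points

section ConstantGroup

variable {O Δ A : Type u} [CommRing O] [CommRing A] [Algebra O A]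

theorem ConstAlg.mul_ind (f : ConstAlg O Δ) (c : Δ) : f * ind c = ev c f • ind c := by
  classical
  apply ext_ev
  intro r
  rw [map_mul, map_smul, ev_ind]
  split_ifs with h
  · rw [h, smul_eq_mul]
  · rw [mul_zero, smul_zero]

theorem ConstAlg.isIdempotentElem_ind (c : Δ) : IsIdempotentElem (ind c : ConstAlg O Δ) := by
  classical
  rw [IsIdempotentElem, ind_mul_ind, if_pos rfl]

variable [Group Δ] [Finite Δ]

theorem eq_constPt_iff {x : Pt O (ConstAlg O Δ) A} {c : Δ} :
    x = constPt O A c ↔ x.ofConv (ConstAlg.ind c) = 1 := by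
  classical
  constructor
  · rintro rfl
    change algebraMap O A (ConstAlg.ev c (ConstAlg.ind c)) = 1
    rw [ConstAlg.ev_ind, if_pos rfl, map_one]
  · intro h
    refine ofConv_injective (AlgHom.ext fun f => ?_)
    have hf := congrArg x.ofConv (ConstAlg.mul_ind f c)
    rw [map_mul, map_smul, h, mul_one, ← Algebra.algebraMap_eq_smul_one] at hf
    exact hf

theorem eq_one_of_mem_identityComponent_constAlg {h : Pt O (ConstAlg O Δ) A}
    (hh : h ∈ identityComponent O (ConstAlg O Δ) A) : h = 1 := by
  rw [← map_one (constPt O A (Δ := Δ)), eq_constPt_iff]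
  exact apply_eq_one_of_mem_identityComponent (ConstAlg.isIdempotentElem_ind 1)
    (if_pos rfl) hh

/-- The indicator function of a point of `Δⁿ`, as an invariant function on the `n`-th power of the
constant group scheme. -/
def tupleInd (O : Type u) [CommRing O] {n : ℕ} (c : Fin n → Δ) : invariants O (ConstAlg O Δ) n :=
  ⟨PiTensorProduct.tprod O fun i => ConstAlg.ind (c i), fun A _ _ h hh g => by
    simp only [eq_one_of_mem_identityComponent_constAlg hh, one_mul, inv_one, mul_one]⟩

theorem evalAt_tupleInd {n : ℕ} (c : Fin n → Δ) (x : Fin n → Pt O (ConstAlg O Δ) A) :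
    evalAt x (tupleInd O c).1 = ∏ i, (x i).ofConv (ConstAlg.ind (c i)) := evalAt_tprod _ _

theorem isIdempotentElem_tupleInd {n : ℕ} (c : Fin n → Δ) : IsIdempotentElem (tupleInd O c) :=
  Subtype.ext <| by
    change PiTensorProduct.tprod O _ * PiTensorProduct.tprod O _ = PiTensorProduct.tprod O _
    rw [PiTensorProduct.tprod_mul_tprod]
    exact congrArg _ (funext fun i => ConstAlg.isIdempotentElem_ind (c i))

theorem evalAt_tupleInd_eq_one_iff {n : ℕ} {c : Fin n → Δ} {x : Fin n → Pt O (ConstAlg O Δ) A} :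
    evalAt x (tupleInd O c).1 = 1 ↔ ∀ i, x i = constPt O A (c i) := by
  simp only [evalAt_tupleInd, eq_constPt_iff]
  refine ⟨fun h i => ?_, fun h => Finset.prod_eq_one fun i _ => h i⟩
  refine (IsIdempotentElem.iff_eq_one_of_isUnit ?_).1
    ((ConstAlg.isIdempotentElem_ind (c i)).map (x i).ofConv)
  exact isUnit_of_dvd_one (h ▸ Finset.dvd_prod_of_mem _ (Finset.mem_univ i))

end ConstantGroup

namespace TorusPt

variable {O M A B : Type u} [CommRing O] [AddCommGroup M] [CommRing A] [Algebra O A]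
  [CommRing B] [Algebra O B] {ι : Type}

/-- The character `(mᵢ) ↦ ∏ tᵢ(mᵢ)` of a direct sum of copies of `M`. -/
def liftFinsupp (t : ι → TorusPt M A) : TorusPt (ι →₀ M) A :=
  ofAddHom (Finsupp.liftAddHom fun i => (t i).toAddHom)

theorem map_liftFinsupp (f : A →ₐ[O] B) (t : ι → TorusPt M A) :
    map f (liftFinsupp t) = liftFinsupp fun i => map f (t i) :=
  ext_val fun _ => (map_prod (Units.map f.toMonoidHom) _ _)

theorem liftFinsupp_comap_single (t : TorusPt (ι →₀ M) A) :
    liftFinsupp (fun i => comap (Finsupp.singleAddHom i) t) = t :=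
  ext_val fun m => by
    conv_rhs => rw [← Finsupp.sum_single m, val_finsuppSum]
    rfl

theorem comap_single_liftFinsupp (t : ι → TorusPt M A) (i : ι) :
    comap (Finsupp.singleAddHom i) (liftFinsupp t) = t i :=
  ext_val fun _ => Finsupp.prod_single_index (val_zero (t i))

theorem liftFinsupp_comap_single_comp {κ : Type} (ζ : ι → κ) (t : TorusPt (κ →₀ M) A) :
    liftFinsupp (fun i => comap (Finsupp.singleAddHom (ζ i)) t) =
      comap (Finsupp.mapDomain.addMonoidHom ζ) t :=
  ext_val fun m => by
    conv_rhs => rw [comap_val, ← Finsupp.sum_single m, map_finsuppSum, val_finsuppSum]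
    simp only [Finsupp.mapDomain.addMonoidHom_apply, Finsupp.mapDomain_single]
    rfl

variable {Γ Δ : Type u} [Group Γ] [Group Δ] [DistribMulAction Δ M]

theorem liftFinsupp_coboundary_mul (π : Γ →* Δ) (γ : ι → Γ) (h : TorusPt M A)
    (t : ι → TorusPt M A) :
    liftFinsupp (fun i => h * (π (γ i) • h)⁻¹ * t i) =
      comap ((d₁ π M).comp (Finsupp.mapDomain.addMonoidHom γ)) h⁻¹ * liftFinsupp t := by
  rw [← liftFinsupp_comap_single (comap _ _ * _)]
  refine congrArg _ (funext fun i => ?_)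
  rw [map_mul, comap_single_liftFinsupp]
  refine congrArg (· * t i) (ext_val fun m => ?_)
  rw [comap_val, comap_val, AddMonoidHom.comp_apply, Finsupp.singleAddHom_apply,
    Finsupp.mapDomain.addMonoidHom_apply, Finsupp.mapDomain_single, d₁_single, inv_val, val_sub,
    mul_inv, inv_inv, mul_comm]
  rfl

end TorusPt

section TupleCycles

/-- The group of tuples `m` of elements of `M` for which the chain `∑ mᵢ [γᵢ]` lies in `S`. -/
abbrev TupleChains {Γ M ι : Type*} [AddCommGroup M] (S : AddSubgroup (Γ →₀ M)) (γ : ι → Γ) :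
    AddSubgroup (ι →₀ M) :=
  S.comap (Finsupp.mapDomain.addMonoidHom γ)

variable {Γ Δ : Type u} [Group Γ] [Group Δ] (π : Γ →* Δ) (M : Type u) [AddCommGroup M]
  [DistribMulAction Δ M] {n : ℕ} (γ : Fin n → Γ)

/-- The group of tuples `(m₁, …, mₙ)` for which the chain `∑ mᵢ [γᵢ]` is a cycle. -/
abbrev TupleCycles : AddSubgroup (Fin n →₀ M) := TupleChains (d₁ π M).ker γ

theorem exact_tupleCycles : Function.Exact (TupleCycles π M γ).subtype
    ((d₁ π M).comp (Finsupp.mapDomain.addMonoidHom γ)) := fun m =>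
  ⟨fun hm => ⟨⟨m, hm⟩, rfl⟩, by rintro ⟨z, rfl⟩; exact z.2⟩

end TupleCycles

namespace SplitGeneralisedTorus

variable {O M Δ H Γ A B : Type u} [CommRing O] [AddCommGroup M] [Group Δ] [Finite Δ]
  [CommRing H] [HopfAlgebra O H] [Group Γ] {G : SplitGeneralisedTorus O M Δ H} {π : Γ →* Δ}
  [CommRing A] [Algebra O A] [CommRing B] [Algebra O B] {n : ℕ}

variable (G π) in
/-- The idempotent of `O[Gⁿ]^{G⁰}` which cuts out the component of `Gⁿ` over
`(π γ₁, …, π γₙ) ∈ Δⁿ`. -/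
def componentIdem (γ : Fin n → Γ) : invariants O H n :=
  pullback G.proj n (tupleInd O fun i => π (γ i))

theorem isIdempotentElem_componentIdem (γ : Fin n → Γ) :
    IsIdempotentElem (componentIdem G π γ) := (isIdempotentElem_tupleInd _).map _

theorem isIdempotentElem_evalAt_componentIdem (γ : Fin n → Γ) (g : Fin n → Pt O H A) :
    IsIdempotentElem (evalAt g (componentIdem G π γ).1) :=
  ((isIdempotentElem_componentIdem γ).map (invariants O H n).val).map (evalAt g)

theorem evalAt_componentIdem_eq_one_iff {γ : Fin n → Γ} {g : Fin n → Pt O H A} :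
    evalAt g (componentIdem G π γ).1 = 1 ↔ ∀ i, G.Proj A (g i) = constPt O A (π (γ i)) := by
  rw [componentIdem, evalAt_pullback]
  exact evalAt_tupleInd_eq_one_iff

theorem PC.Θ_componentIdem (T : G.PC π A) (γ : Fin (n + 1) → Γ) :
    T.1.Θ n (componentIdem G π γ) γ = 1 := by
  have h := congrArg (fun S => S.Θ n (tupleInd O fun i => π (γ i)) γ) T.2
  exact h.trans (evalAt_tupleInd_eq_one_iff.2 fun i => rfl)

variable (ρ₀ : G.Rep π O) (γ : Fin n → Γ)

/-- The generic point of the component of `Gⁿ` over `(π γ₁, …, π γₙ)`, which is the translate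
`𝔇(Mⁿ) (ρ₀(γ₁), …, ρ₀(γₙ))`. -/
def genericPt (i : Fin n) : Pt O H (AddMonoidAlgebra O (Fin n →₀ M)) :=
  G.ι _ (TorusPt.comap (Finsupp.singleAddHom i) (TorusPt.univ O _)) * baseHom ρ₀ _ (γ i)

/-- Evaluation of functions on `Gⁿ` at the generic point of a component. -/
def evalGeneric : CoordPow O H n →ₐ[O] AddMonoidAlgebra O (Fin n →₀ M) :=
  evalAt (genericPt ρ₀ γ)

theorem map_ι_mul_baseHom (f : A →ₐ[O] B) (t : TorusPt M A) (γ : Γ) :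
    Pt.map H f (G.ι A t * baseHom ρ₀ A γ) = G.ι B (TorusPt.map f t) * baseHom ρ₀ B γ := by
  rw [map_mul, map_baseHom, ι_map]

theorem Proj_ι_mul_baseHom (t : TorusPt M A) (γ : Γ) :
    G.Proj A (G.ι A t * baseHom ρ₀ A γ) = constPt O A (π γ) := by
  rw [map_mul, Proj_ι, one_mul, Proj_baseHom]

theorem evalAt_ι_mul_baseHom (t : Fin n → TorusPt M A) (f : CoordPow O H n) :
    evalAt (fun i => G.ι A (t i) * baseHom ρ₀ A (γ i)) f =
      (TorusPt.liftFinsupp t).charHom O (evalGeneric ρ₀ γ f) := by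
  rw [evalGeneric, ← AlgHom.comp_apply, algHom_comp_evalAt]
  congr 2
  ext1 i
  rw [genericPt, map_ι_mul_baseHom]
  congr 2
  calc t i = TorusPt.comap (Finsupp.singleAddHom i) (TorusPt.liftFinsupp t) :=
        (TorusPt.comap_single_liftFinsupp t i).symm
    _ = TorusPt.comap (Finsupp.singleAddHom i)
          (TorusPt.map ((TorusPt.liftFinsupp t).charHom O) (TorusPt.univ O _)) :=
        congrArg _ ((TorusPt.charEquiv O).symm_apply_apply _).symm

theorem evalGeneric_componentIdem : evalGeneric ρ₀ γ (componentIdem G π γ).1 = 1 :=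
  evalAt_componentIdem_eq_one_iff.2 fun _ => Proj_ι_mul_baseHom ρ₀ _ _

theorem exists_eq_ι_mul_baseHom {γ : Fin n → Γ} {g : Fin n → Pt O H A}
    (hg : evalAt g (componentIdem G π γ).1 = 1) :
    ∃ t : Fin n → TorusPt M A, ∀ i, g i = G.ι A (t i) * baseHom ρ₀ A (γ i) := by
  have exists_quotient (i : Fin n) : ∃ t, G.ι A t = g i * (baseHom ρ₀ A (γ i))⁻¹ :=
    exists_ι_eq <| by
      rw [map_mul, map_inv, evalAt_componentIdem_eq_one_iff.1 hg, Proj_baseHom, mul_inv_cancel]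
  choose t ht using exists_quotient
  exact ⟨t, fun i => by rw [ht, inv_mul_cancel_right]⟩

/-- The quotient represents the locus of `Spec A` where `g` lies in the component. -/
theorem exists_quotient_eq_ι_mul_baseHom (g : Fin n → Pt O H A) :
    ∃ (R : Type u) (_ : CommRing R) (_ : Algebra O R) (q : A →ₐ[O] R) (t : Fin n → TorusPt M R),
      Function.Surjective q ∧
      (∀ a b, q a = q b ↔
        evalAt g (componentIdem G π γ).1 * a = evalAt g (componentIdem G π γ).1 * b) ∧
      ∀ i, Pt.map H q (g i) = G.ι R (t i) * baseHom ρ₀ R (γ i) := by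
  let I := Ideal.span {1 - evalAt g (componentIdem G π γ).1}
  obtain ⟨t, ht⟩ := exists_eq_ι_mul_baseHom (γ := γ) ρ₀ (g := fun i =>
    Pt.map H (Ideal.Quotient.mkₐ O I) (g i)) <| by
      rw [← algHom_comp_evalAt]
      exact mk_span_one_sub _
  exact ⟨A ⧸ I, _, _, Ideal.Quotient.mkₐ O I, t, Ideal.Quotient.mkₐ_surjective O I,
    fun _ _ => mk_eq_mk_iff_of_isIdempotentElem (isIdempotentElem_evalAt_componentIdem γ g), ht⟩

theorem componentIdem_mul_eq_of_evalGeneric_eq {f f' : CoordPow O H n}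
    (h : evalGeneric ρ₀ γ f = evalGeneric ρ₀ γ f') :
    (componentIdem G π γ).1 * f = (componentIdem G π γ).1 * f' := by
  obtain ⟨R, _, _, q, t, -, hq, ht⟩ := exists_quotient_eq_ι_mul_baseHom ρ₀ γ (coordPt O H n)
  rw [evalAt_coordPt] at hq
  have hfactor (x : CoordPow O H n) :
      q x = (TorusPt.liftFinsupp t).charHom O (evalGeneric ρ₀ γ x) := by
    rw [← evalAt_ι_mul_baseHom, ← funext ht, ← algHom_comp_evalAt, evalAt_coordPt]
    rfl
  exact (hq f f').1 (by rw [hfactor, hfactor, h])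

theorem evalGeneric_surjective : Function.Surjective (evalGeneric ρ₀ γ) := by
  obtain ⟨R, _, _, q, t, hsurj, hq, ht⟩ := exists_quotient_eq_ι_mul_baseHom ρ₀ γ (coordPt O H n)
  have hker : RingHom.ker q ≤ RingHom.ker (evalGeneric ρ₀ γ) := fun a ha => by
    have hmul := (hq a 0).1 (ha.trans (map_zero q).symm)
    rw [evalAt_coordPt, AlgHom.id_apply, mul_zero] at hmul
    have hmap := congrArg (evalGeneric ρ₀ γ) hmul
    rwa [map_mul, evalGeneric_componentIdem, one_mul, map_zero] at hmap
  let k := AlgHom.liftOfSurjective q hsurj (evalGeneric ρ₀ γ) hker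
  have hkq : k.comp q = evalGeneric ρ₀ γ :=
    AlgHom.ext fun a => AlgHom.liftOfSurjective_apply q hsurj _ hker a
  have hgeneric (i : Fin n) : TorusPt.map k (t i) =
      TorusPt.comap (Finsupp.singleAddHom i) (TorusPt.univ O _) := by
    refine ι_injective (G := G) (mul_right_cancel (b := baseHom ρ₀ _ (γ i)) ?_)
    rw [← map_ι_mul_baseHom, ← ht]
    change Pt.map H (k.comp q) (coordPt O H n i) = _
    rw [hkq]
    exact map_evalAt_coordPt _ i
  have hkt : k.comp ((TorusPt.liftFinsupp t).charHom O) = AlgHom.id O _ := by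
    rw [TorusPt.comp_charHom, TorusPt.map_liftFinsupp, funext hgeneric,
      TorusPt.liftFinsupp_comap_single, TorusPt.charHom_univ]
  intro x
  obtain ⟨f, hf⟩ := hsurj ((TorusPt.liftFinsupp t).charHom O x)
  refine ⟨f, ?_⟩
  rw [← hkq, AlgHom.comp_apply, hf, ← AlgHom.comp_apply, hkt, AlgHom.id_apply]

variable [DistribMulAction Δ M] (hG : G.IsConjugationAction)

include hG

theorem evalAt_conj_ι_mul_baseHom (h : TorusPt M A) (t : Fin n → TorusPt M A)
    (f : CoordPow O H n) :
    evalAt (fun i => G.ι A h * (G.ι A (t i) * baseHom ρ₀ A (γ i)) * (G.ι A h)⁻¹) f =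
      (TorusPt.comap ((d₁ π M).comp (Finsupp.mapDomain.addMonoidHom γ)) h⁻¹ *
        TorusPt.liftFinsupp t).charHom O (evalGeneric ρ₀ γ f) := by
  simp only [conj_ι_mul_baseHom hG ρ₀]
  rw [evalAt_ι_mul_baseHom, TorusPt.liftFinsupp_coboundary_mul]

theorem evalGeneric_mem_range_of_mem_invariants {f : CoordPow O H n}
    (hf : f ∈ invariants O H n) :
    evalGeneric ρ₀ γ f ∈ (mapDomainAlgHom O O (TupleCycles π M γ).subtype).range := by
  refine (TorusPt.mem_range_mapDomainAlgHom_iff Subtype.val_injective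
    (exact_tupleCycles π M γ)).2 fun A _ _ h a => ?_
  have hconj := hf A (G.ι A h⁻¹) (G.range_incl A ▸ ⟨h⁻¹, rfl⟩)
    (fun i => G.ι A (TorusPt.comap (Finsupp.singleAddHom i) a) * baseHom ρ₀ A (γ i))
  rwa [evalAt_conj_ι_mul_baseHom ρ₀ γ hG, evalAt_ι_mul_baseHom, inv_inv,
    TorusPt.liftFinsupp_comap_single] at hconj

theorem mem_invariants_of_evalGeneric_mem_range {f : CoordPow O H n}
    (hf : (componentIdem G π γ).1 * f = f)
    (hrange : evalGeneric ρ₀ γ f ∈ (mapDomainAlgHom O O (TupleCycles π M γ).subtype).range) :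
    f ∈ invariants O H n := by
  intro A _ _ h hh g
  obtain ⟨τ, rfl⟩ := (G.range_incl A).ge hh
  change evalAt (fun i => G.ι A τ * g i * (G.ι A τ)⁻¹) f = evalAt g f
  obtain ⟨R, _, _, q, t, -, hq, ht⟩ := exists_quotient_eq_ι_mul_baseHom ρ₀ γ g
  have hqf : q (evalAt (fun i => G.ι A τ * g i * (G.ι A τ)⁻¹) f) = q (evalAt g f) := by
    rw [← AlgHom.comp_apply, ← AlgHom.comp_apply, algHom_comp_evalAt, algHom_comp_evalAt]
    simp only [map_mul, map_inv, ht, ← ι_map]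
    rw [evalAt_conj_ι_mul_baseHom ρ₀ γ hG, evalAt_ι_mul_baseHom]
    exact (TorusPt.mem_range_mapDomainAlgHom_iff Subtype.val_injective
      (exact_tupleCycles π M γ)).1 hrange _ _ _
  have hε := (componentIdem G π γ).2 A _ hh g
  rw [← hf, map_mul, map_mul]
  exact (congrArg (· * _) hε).trans ((hq _ _).1 hqf)

end SplitGeneralisedTorus

/-! ### Gluing characters of tuples -/

section Gluing

variable {Γ M : Type u} [AddCommGroup M]

theorem exists_injective_forall_mem_range [Nonempty Γ] (F : Finset Γ) :
    ∃ (n : ℕ) (η : Fin (n + 1) → Γ), Function.Injective η ∧ ∀ γ ∈ F, γ ∈ Set.range η := by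
  classical
  obtain ⟨γ₀⟩ := ‹Nonempty Γ›
  obtain ⟨n, η, hη, hrange⟩ := (insert γ₀ F).finite_toSet.fin_param
  cases n with
  | zero =>
    obtain ⟨i, -⟩ := hrange.ge (Finset.mem_insert_self γ₀ F)
    exact i.elim0
  | succ n => exact ⟨n, η, hη, fun γ hγ => hrange.ge (Finset.mem_insert_of_mem hγ)⟩

theorem exists_mapDomain_eq {ι : Type} {η : ι → Γ} (hη : Function.Injective η) {z : Γ →₀ M}
    (hz : ∀ γ ∈ z.support, γ ∈ Set.range η) : ∃ x, Finsupp.mapDomain η x = z :=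
  ⟨Finsupp.comapDomain η z hη.injOn, Finsupp.mapDomain_comapDomain η hη z hz⟩

namespace TorusPt

variable {A : Type u} [CommRing A] {S : AddSubgroup (Γ →₀ M)}
  {v : ∀ (n : ℕ) (γ : Fin (n + 1) → Γ), TorusPt (TupleChains S γ) A}
  (hv : ∀ (k n : ℕ) (ζ : Fin (k + 1) → Fin (n + 1)) (γ : Fin (n + 1) → Γ)
    (x : TupleChains S (γ ∘ ζ)) (y : TupleChains S γ),
    Finsupp.mapDomain ζ x.1 = y.1 → (v k (γ ∘ ζ)).val x = (v n γ).val y)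

include hv

theorem val_eq_of_mapDomain_eq_of_injective {k n : ℕ} {γ : Fin (k + 1) → Γ}
    {η : Fin (n + 1) → Γ} (hη : Function.Injective η) (hγ : ∀ i, γ i ∈ Set.range η)
    (x : TupleChains S γ) (y : TupleChains S η)
    (h : Finsupp.mapDomain γ x.1 = Finsupp.mapDomain η y.1) : (v k γ).val x = (v n η).val y := by
  choose ζ hζ using hγ
  obtain rfl : η ∘ ζ = γ := funext hζ
  exact hv k n ζ η x y (Finsupp.mapDomain_injective hη (Finsupp.mapDomain_comp.symm.trans h))

variable [Nonempty Γ]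

theorem val_eq_of_mapDomain_eq {k n : ℕ} {γ : Fin (k + 1) → Γ} {γ' : Fin (n + 1) → Γ}
    (x : TupleChains S γ) (y : TupleChains S γ')
    (h : Finsupp.mapDomain γ x.1 = Finsupp.mapDomain γ' y.1) : (v k γ).val x = (v n γ').val y := by
  classical
  obtain ⟨l, η, hη, hrange⟩ :=
    exists_injective_forall_mem_range (Finset.univ.image γ ∪ Finset.univ.image γ')
  have hγ (i : Fin (k + 1)) : γ i ∈ Set.range η :=
    hrange _ (Finset.mem_union_left _ (Finset.mem_image_of_mem γ (Finset.mem_univ i)))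
  have hγ' (i : Fin (n + 1)) : γ' i ∈ Set.range η :=
    hrange _ (Finset.mem_union_right _ (Finset.mem_image_of_mem γ' (Finset.mem_univ i)))
  obtain ⟨z, hz⟩ := exists_mapDomain_eq hη (z := Finsupp.mapDomain γ x.1) fun g hg => by
    obtain ⟨i, -, rfl⟩ := Finset.mem_image.1 (Finsupp.mapDomain_support hg)
    exact hγ i
  let z' : TupleChains S η := ⟨z, by
    rw [AddSubgroup.mem_comap, Finsupp.mapDomain.addMonoidHom_apply, hz]
    exact x.2⟩
  exact (val_eq_of_mapDomain_eq_of_injective hv hη hγ x z' hz.symm).trans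
    (val_eq_of_mapDomain_eq_of_injective hv hη hγ' y z' (h.symm.trans hz.symm)).symm

/-- A compatible family of characters of tuples glues to a character of chains, since any two chains
come from a common tuple. -/
theorem exists_val_mapDomain_eq : ∃ t : TorusPt S A, ∀ (n : ℕ) (γ : Fin (n + 1) → Γ)
    (x : TupleChains S γ),
      t.val ⟨Finsupp.mapDomain γ x.1, AddSubgroup.mem_comap.1 x.2⟩ = (v n γ).val x := by
  classical
  have exists_value (z : S) : ∃ a : Aˣ, ∀ (n : ℕ) (γ : Fin (n + 1) → Γ)
      (x : TupleChains S γ), Finsupp.mapDomain γ x.1 = z.1 → (v n γ).val x = a := by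
    obtain ⟨n, η, hη, hrange⟩ := exists_injective_forall_mem_range z.1.support
    obtain ⟨y, hy⟩ := exists_mapDomain_eq hη hrange
    exact ⟨(v n η).val ⟨y, by
      rw [AddSubgroup.mem_comap, Finsupp.mapDomain.addMonoidHom_apply, hy]
      exact z.2⟩, fun k γ x hx => val_eq_of_mapDomain_eq hv x _ (hx.trans hy.symm)⟩
  choose a ha using exists_value
  have a_add (z z' : S) : a (z + z') = a z * a z' := by
    obtain ⟨n, η, hη, hrange⟩ :=
      exists_injective_forall_mem_range (z.1.support ∪ z'.1.support)
    obtain ⟨y, hy⟩ := exists_mapDomain_eq hη fun g hg => hrange g (Finset.mem_union_left _ hg)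
    obtain ⟨y', hy'⟩ := exists_mapDomain_eq hη fun g hg => hrange g (Finset.mem_union_right _ hg)
    let x : TupleChains S η := ⟨y, (congrArg (· ∈ S) hy).mpr z.2⟩
    let x' : TupleChains S η := ⟨y', (congrArg (· ∈ S) hy').mpr z'.2⟩
    rw [← ha z n η x hy, ← ha z' n η x' hy', ← val_add]
    exact (ha _ n η _ (Finsupp.mapDomain_add.trans (congrArg₂ (· + ·) hy hy'))).symm
  exact ⟨ofAddHom (AddMonoidHom.mk' (fun z => .ofMul (a z)) a_add),
    fun n γ x => (ha _ n γ x rfl).symm⟩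

end TorusPt

end Gluing

/-! ### Pseudocharacters -/

namespace SplitGeneralisedTorus

variable {O M Δ H Γ A B : Type u} [CommRing O] [AddCommGroup M] [Group Δ] [Finite Δ]
  [CommRing H] [HopfAlgebra O H] [Group Γ] {G : SplitGeneralisedTorus O M Δ H} {π : Γ →* Δ}
  [CommRing A] [Algebra O A] [CommRing B] [Algebra O B] {k n : ℕ}

theorem PC.map_ofRep (f : A →ₐ[O] B) (ρ : G.Rep π A) :
    PC.map G f (ofRep G ρ) = ofRep G (Rep.map G f ρ) :=
  Subtype.ext (PseudoChar.map_ofRep f ρ.1)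

theorem evalGeneric_reindex (ρ₀ : G.Rep π O) (ζ : Fin k → Fin n) (γ : Fin n → Γ)
    (f : invariants O H k) :
    evalGeneric ρ₀ γ (reindex ζ f).1 =
      mapDomainAlgHom O O (Finsupp.mapDomain.addMonoidHom ζ) (evalGeneric ρ₀ (γ ∘ ζ) f.1) := by
  rw [evalGeneric, evalAt_reindex, ← TorusPt.charHom_comap_univ,
    ← TorusPt.liftFinsupp_comap_single_comp]
  exact evalAt_ι_mul_baseHom ρ₀ (γ ∘ ζ) _ f.1

variable [DistribMulAction Δ M] (hG : G.IsConjugationAction) (ρ₀ : G.Rep π O)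

/-- The restriction of invariant functions on `Gⁿ` to the component over `(π γ₁, …, π γₙ)`, where
they are spanned by the characters of tuples of cycles. -/
def cycleEval (γ : Fin n → Γ) :
    invariants O H n →ₐ[O] AddMonoidAlgebra O (TupleCycles π M γ) :=
  (AlgEquiv.ofInjective (mapDomainAlgHom O O (TupleCycles π M γ).subtype)
    (AddMonoidAlgebra.mapDomain_injective Subtype.val_injective)).symm.toAlgHom.comp <|
      ((evalGeneric ρ₀ γ).comp (invariants O H n).val).codRestrict _ fun f =>
        evalGeneric_mem_range_of_mem_invariants ρ₀ γ hG f.2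

theorem mapDomain_cycleEval (γ : Fin n → Γ) (f : invariants O H n) :
    mapDomainAlgHom O O (TupleCycles π M γ).subtype (cycleEval hG ρ₀ γ f) =
      evalGeneric ρ₀ γ f.1 :=
  congrArg Subtype.val ((AlgEquiv.ofInjective (mapDomainAlgHom O O (TupleCycles π M γ).subtype)
    (AddMonoidAlgebra.mapDomain_injective Subtype.val_injective)).apply_symm_apply _)

theorem cycleEval_eq_iff {γ : Fin n → Γ} {f : invariants O H n}
    {y : AddMonoidAlgebra O (TupleCycles π M γ)} :
    cycleEval hG ρ₀ γ f = y ↔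
      evalGeneric ρ₀ γ f.1 = mapDomainAlgHom O O (TupleCycles π M γ).subtype y := by
  rw [← mapDomain_cycleEval hG ρ₀]
  exact (AddMonoidAlgebra.mapDomain_injective Subtype.val_injective).eq_iff.symm

theorem cycleEval_surjective (γ : Fin n → Γ) : Function.Surjective (cycleEval hG ρ₀ γ) := by
  intro y
  obtain ⟨f, hf⟩ :=
    evalGeneric_surjective ρ₀ γ (mapDomainAlgHom O O (TupleCycles π M γ).subtype y)
  have hεf : evalGeneric ρ₀ γ ((componentIdem G π γ).1 * f) =
      mapDomainAlgHom O O (TupleCycles π M γ).subtype y := by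
    rw [map_mul, evalGeneric_componentIdem, one_mul, hf]
  have hidem : (componentIdem G π γ).1 * (componentIdem G π γ).1 = (componentIdem G π γ).1 :=
    congrArg Subtype.val (isIdempotentElem_componentIdem γ)
  exact ⟨⟨_, mem_invariants_of_evalGeneric_mem_range ρ₀ γ hG
    (by rw [← mul_assoc, hidem]) ⟨y, hεf.symm⟩⟩, (cycleEval_eq_iff hG ρ₀).2 hεf⟩

theorem charHom_evalGeneric_of_cycleEval_eq {γ : Fin n → Γ} {f : invariants O H n}
    {x : TupleCycles π M γ} (hf : cycleEval hG ρ₀ γ f = single x 1)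
    (a : TorusPt (Fin n →₀ M) A) : a.charHom O (evalGeneric ρ₀ γ f.1) = (a.val x.1 : A) := by
  rw [(cycleEval_eq_iff hG ρ₀).1 hf, TorusPt.mapDomainAlgHom_single, TorusPt.charHom_single_one]
  rfl

namespace PC

variable (T : G.PC π A)

theorem Θ_eq_zero_of_cycleEval_eq_zero {γ : Fin (n + 1) → Γ} {f : invariants O H (n + 1)}
    (hf : cycleEval hG ρ₀ γ f = 0) : T.1.Θ n f γ = 0 := by
  have hzero : componentIdem G π γ * f = 0 := by
    rw [cycleEval_eq_iff, map_zero, ← map_zero (evalGeneric ρ₀ γ)] at hf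
    exact Subtype.ext ((componentIdem_mul_eq_of_evalGeneric_eq ρ₀ γ hf).trans (mul_zero _))
  calc T.1.Θ n f γ = T.1.Θ n (componentIdem G π γ * f) γ := by
        rw [map_mul, Pi.mul_apply, Θ_componentIdem, one_mul]
    _ = 0 := by rw [hzero, map_zero, Pi.zero_apply]

/-- The character of the group of tuples of cycles through which an admissible pseudocharacter
factors at `γ ∈ Γⁿ`. -/
def tupleChar (γ : Fin (n + 1) → Γ) : TorusPt (TupleCycles π M γ) A :=
  (TorusPt.charEquiv O).symm <| AlgHom.liftOfSurjective (cycleEval hG ρ₀ γ)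
    (cycleEval_surjective hG ρ₀ γ) ((Pi.evalAlgHom O _ γ).comp (T.1.Θ n)) fun _ hf =>
      Θ_eq_zero_of_cycleEval_eq_zero hG ρ₀ T hf

theorem charHom_tupleChar (γ : Fin (n + 1) → Γ) (f : invariants O H (n + 1)) :
    (tupleChar hG ρ₀ T γ).charHom O (cycleEval hG ρ₀ γ f) = T.1.Θ n f γ := by
  rw [tupleChar]
  exact (DFunLike.congr_fun ((TorusPt.charEquiv O).apply_symm_apply _) _).trans
    (AlgHom.liftOfSurjective_apply ..)

theorem tupleChar_val_of_cycleEval_eq {γ : Fin (n + 1) → Γ} {f : invariants O H (n + 1)}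
    {x : TupleCycles π M γ} (hf : cycleEval hG ρ₀ γ f = single x 1) :
    ((tupleChar hG ρ₀ T γ).val x : A) = T.1.Θ n f γ := by
  rw [← charHom_tupleChar hG ρ₀, hf, TorusPt.charHom_single_one]

theorem ext_tupleChar {T T' : G.PC π A} (h : ∀ (n : ℕ) (γ : Fin (n + 1) → Γ),
    tupleChar hG ρ₀ T γ = tupleChar hG ρ₀ T' γ) : T = T' :=
  Subtype.ext <| PseudoChar.ext <| funext fun n => AlgHom.ext fun f => funext fun γ => by
    rw [← charHom_tupleChar hG ρ₀, h, charHom_tupleChar]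

theorem tupleChar_comp_val (ζ : Fin (k + 1) → Fin (n + 1)) (γ : Fin (n + 1) → Γ)
    (x : TupleCycles π M (γ ∘ ζ)) (y : TupleCycles π M γ) (h : Finsupp.mapDomain ζ x.1 = y.1) :
    (tupleChar hG ρ₀ T (γ ∘ ζ)).val x = (tupleChar hG ρ₀ T γ).val y := by
  obtain ⟨f, hf⟩ := cycleEval_surjective hG ρ₀ (γ ∘ ζ) (single x 1)
  have hreindex : cycleEval hG ρ₀ γ (reindex ζ f) = single y 1 := by
    rw [cycleEval_eq_iff, evalGeneric_reindex, (cycleEval_eq_iff hG ρ₀).1 hf]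
    simp only [TorusPt.mapDomainAlgHom_single]
    exact congrArg (single · 1) h
  refine Units.ext ?_
  rw [tupleChar_val_of_cycleEval_eq hG ρ₀ T hf, tupleChar_val_of_cycleEval_eq hG ρ₀ T hreindex,
    T.1.reindex']
  rfl

theorem tupleChar_val_boundary (γ γ' : Γ) {m : M} {x : TupleCycles π M ![γ, γ', γ * γ']}
    (hx : x.1 = Finsupp.single 0 m + Finsupp.single 1 ((π γ)⁻¹ • m) - Finsupp.single 2 m) :
    (tupleChar hG ρ₀ T ![γ, γ', γ * γ']).val x = 1 := by
  obtain ⟨f, hf⟩ := cycleEval_surjective hG ρ₀ ![γ, γ', γ * γ'] (single x 1)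
  let ζ : Fin 4 → Fin 2 := ![0, 1, 0, 1]
  let t (i : Fin 2) : TorusPt M (AddMonoidAlgebra O (Fin 2 →₀ M)) :=
    TorusPt.comap (Finsupp.singleAddHom i) (TorusPt.univ O _)
  have hγ : mulLast (![γ, γ'] ∘ ζ) = ![γ, γ', γ * γ'] := by
    ext i
    fin_cases i <;> rfl
  have hgeneric : mulLast (fun i => genericPt ρ₀ ![γ, γ'] (ζ i)) = fun i =>
      G.ι _ ((![t 0, t 1, t 0 * π γ • t 1] : Fin 3 → TorusPt M _) i) *
        baseHom ρ₀ _ (![γ, γ', γ * γ'] i) := by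
    ext1 i
    fin_cases i
    · rfl
    · rfl
    · exact ι_mul_baseHom_mul hG ρ₀ (t 0) (t 1) γ γ'
  have hval : (TorusPt.liftFinsupp ![t 0, t 1, t 0 * π γ • t 1]).val x.1 = 1 := by
    rw [hx, TorusPt.val_sub, TorusPt.val_add]
    simp only [← Finsupp.singleAddHom_apply, ← TorusPt.comap_val,
      TorusPt.comap_single_liftFinsupp]
    exact mul_inv_cancel _
  have hone : cycleEval hG ρ₀ ![γ, γ'] (reindex ζ (hat f)) = 1 := by
    rw [cycleEval_eq_iff, map_one, evalGeneric, evalAt_reindex, evalAt_hat, hgeneric,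
      evalAt_ι_mul_baseHom, charHom_evalGeneric_of_cycleEval_eq hG ρ₀ hf, hval, Units.val_one]
  refine Units.ext ?_
  calc ((tupleChar hG ρ₀ T ![γ, γ', γ * γ']).val x : A)
      = T.1.Θ 2 f ![γ, γ', γ * γ'] := tupleChar_val_of_cycleEval_eq hG ρ₀ T hf
    _ = T.1.Θ 3 (hat f) (![γ, γ'] ∘ ζ) := by rw [T.1.hat', hγ]
    _ = T.1.Θ 1 (reindex ζ (hat f)) ![γ, γ'] := (T.1.reindex' 3 1 ζ (hat f) ![γ, γ']).symm
    _ = 1 := by rw [← charHom_tupleChar hG ρ₀, hone, map_one]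

theorem exists_homologyChar : ∃ t : TorusPt (HomologyOne π M) A, ∀ (n : ℕ)
    (γ : Fin (n + 1) → Γ) (x : TupleCycles π M γ),
      t.val (QuotientAddGroup.mk ⟨Finsupp.mapDomain γ x.1, x.2⟩) =
        (tupleChar hG ρ₀ T γ).val x := by
  obtain ⟨t, ht⟩ := TorusPt.exists_val_mapDomain_eq
    (fun _ _ ζ γ x y h => tupleChar_comp_val hG ρ₀ T ζ γ x y h)
  have hboundary : t.toAddHom.comp ((d₂ π M).codRestrict (d₁ π M).ker d₁_d₂) = 0 := by
    refine Finsupp.addHom_ext fun ⟨γ, γ'⟩ m => ?_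
    let x : TupleCycles π M ![γ, γ', γ * γ'] := ⟨Finsupp.single 0 m +
      Finsupp.single 1 ((π γ)⁻¹ • m) - Finsupp.single 2 m,
        (congrArg (d₁ π M) (d₂_single_eq_mapDomain γ γ' m).symm).trans (d₁_d₂ _)⟩
    have hx : (d₂ π M).codRestrict (d₁ π M).ker d₁_d₂ (Finsupp.single (γ, γ') m) =
        ⟨Finsupp.mapDomain ![γ, γ', γ * γ'] x.1, x.2⟩ := Subtype.ext (d₂_single_eq_mapDomain γ γ' m)
    rw [AddMonoidHom.comp_apply, hx]
    exact congrArg Additive.ofMul ((ht _ _ x).trans (tupleChar_val_boundary hG ρ₀ T γ γ' rfl))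
  refine ⟨TorusPt.ofAddHom (QuotientAddGroup.lift _ t.toAddHom ?_), ht⟩
  rintro ⟨z, hz⟩ hz'
  obtain ⟨y, rfl⟩ := AddSubgroup.mem_addSubgroupOf.1 hz'
  exact DFunLike.congr_fun hboundary y

end PC

variable (s : CosetReps π)

theorem PC.tupleChar_ofRep_val (ρ : G.Rep π A) (γ : Fin (n + 1) → Γ) (x : TupleCycles π M γ) :
    (tupleChar hG ρ₀ (ofRep G ρ) γ).val x =
      (homologyChar hG ρ₀ s ρ).val (QuotientAddGroup.mk ⟨Finsupp.mapDomain γ x.1, x.2⟩) := by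
  obtain ⟨Φ, rfl⟩ := (twistEquiv hG ρ₀ A).surjective ρ
  obtain ⟨f, hf⟩ := cycleEval_surjective hG ρ₀ γ (single x 1)
  have hprod : (Finsupp.mapDomain γ x.1).prod (fun g m => (Φ.1 g).val m) =
      (TorusPt.liftFinsupp fun i => Φ.1 (γ i)).val x.1 :=
    Finsupp.prod_mapDomain_index (fun _ => TorusPt.val_zero _) fun _ => TorusPt.val_add _
  refine Units.ext ?_
  rw [homologyChar_twistEquiv_mk, hprod, tupleChar_val_of_cycleEval_eq hG ρ₀ _ hf,
    ← charHom_evalGeneric_of_cycleEval_eq hG ρ₀ hf, ← evalAt_ι_mul_baseHom]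
  rfl

theorem PC.ofRep_eq_ofRep_iff {ρ σ : G.Rep π A} :
    ofRep G ρ = ofRep G σ ↔ homologyChar hG ρ₀ s ρ = homologyChar hG ρ₀ s σ := by
  constructor
  · intro h
    refine TorusPt.ext_val fun y => ?_
    obtain ⟨z, rfl⟩ := QuotientAddGroup.mk_surjective y
    obtain ⟨n, η, hη, hrange⟩ := exists_injective_forall_mem_range z.1.support
    obtain ⟨x, hx⟩ := exists_mapDomain_eq hη hrange
    let x' : TupleCycles π M η := ⟨x, (congrArg (d₁ π M) hx).trans z.2⟩
    have hz : ⟨Finsupp.mapDomain η x'.1, x'.2⟩ = z := Subtype.ext hx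
    rw [← hz, ← tupleChar_ofRep_val, h, tupleChar_ofRep_val]
  · intro h
    refine ext_tupleChar hG ρ₀ fun n γ => TorusPt.ext_val fun x => ?_
    rw [tupleChar_ofRep_val _ _ s, h, tupleChar_ofRep_val]

include hG ρ₀ s in
theorem PC.ofRep_surjective : Function.Surjective (ofRep G : G.Rep π A → G.PC π A) := by
  intro T
  obtain ⟨t, ht⟩ := exists_homologyChar hG ρ₀ T
  obtain ⟨ρ, rfl⟩ := homologyChar_surjective hG ρ₀ s t
  exact ⟨ρ, ext_tupleChar hG ρ₀ fun n γ => TorusPt.ext_val fun x => by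
    rw [tupleChar_ofRep_val hG ρ₀ s, ht]⟩

/-- The bijection between characters of `H₁(Γ, M)` and admissible pseudocharacters, under which the
character of a representation `ρ` corresponds to `Θ_ρ`. -/
def charPCEquiv (A : Type u) [CommRing A] [Algebra O A] :
    TorusPt (HomologyOne π M) A ≃ G.PC π A :=
  Equiv.ofBijective
    (fun t => PC.ofRep G (Function.surjInv (homologyChar_surjective hG ρ₀ s) t)) <| by
      constructor
      · intro t t' h
        simpa only [PC.ofRep_eq_ofRep_iff hG ρ₀ s, Function.surjInv_eq] using h
      · intro T
        obtain ⟨ρ, rfl⟩ := PC.ofRep_surjective hG ρ₀ s T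
        exact ⟨homologyChar hG ρ₀ s ρ,
          (PC.ofRep_eq_ofRep_iff hG ρ₀ s).2 (Function.surjInv_eq _ _)⟩

theorem charPCEquiv_homologyChar (ρ : G.Rep π A) :
    charPCEquiv hG ρ₀ s A (homologyChar hG ρ₀ s ρ) = PC.ofRep G ρ :=
  (PC.ofRep_eq_ofRep_iff hG ρ₀ s).2 (Function.surjInv_eq _ _)

theorem map_charPCEquiv (f : A →ₐ[O] B) (t : TorusPt (HomologyOne π M) A) :
    PC.map G f (charPCEquiv hG ρ₀ s A t) = charPCEquiv hG ρ₀ s B (TorusPt.map f t) := by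
  obtain ⟨ρ, rfl⟩ := homologyChar_surjective hG ρ₀ s t
  rw [← homologyChar_map, charPCEquiv_homologyChar, charPCEquiv_homologyChar, PC.map_ofRep]

/-- The functor of admissible pseudocharacters is represented by `O[H₁(Γ, M)]`. -/
def pcCorepresentableBy : (G.pcFunctor π).CorepresentableBy (grpAlg O (HomologyOne π M)) where
  homEquiv {A} := (TorusPt.pointEquiv A).trans (charPCEquiv hG ρ₀ s A)
  homEquiv_comp g f :=
    (map_charPCEquiv hG ρ₀ s g.hom ((TorusPt.charEquiv O).symm f.hom)).symm

theorem pcCorepresentableBy_homEquiv_comp (A : CommAlgCat.{u} O)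
    (ψ : grpAlg O (s.Coinv M) ⟶ A) :
    (pcCorepresentableBy hG ρ₀ s).homEquiv
        (CommAlgCat.ofHom (mapDomainAlgHom O O (s.homologyHom M)) ≫ ψ) =
      PC.ofRep G (G.ofPoint (repCorepresentableBy hG ρ₀ s) A ψ) := by
  obtain ⟨a, rfl⟩ := (TorusPt.pointEquiv A).symm.surjective ψ
  have hcomap : TorusPt.pointEquiv A (CommAlgCat.ofHom (mapDomainAlgHom O O (s.homologyHom M)) ≫
      (TorusPt.pointEquiv A).symm a) = TorusPt.comap (s.homologyHom M) a :=
    ((TorusPt.pointEquiv A).eq_symm_apply).1 <|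
      CommAlgCat.hom_ext (TorusPt.charHom_comp_mapDomain (s.homologyHom M) a)
  have hpoint : G.ofPoint (repCorepresentableBy hG ρ₀ s) A ((TorusPt.pointEquiv A).symm a) =
      charRepEquiv hG ρ₀ s A a :=
    congrArg (charRepEquiv hG ρ₀ s A) ((TorusPt.pointEquiv A).apply_symm_apply a)
  rw [hpoint, ← charPCEquiv_homologyChar hG ρ₀ s, homologyChar_charRepEquiv, ← hcomap]
  rfl

end SplitGeneralisedTorus

end

end GenTorus

open GenTorus SplitGeneralisedTorus AddMonoidAlgebra in
theorem mainTheorem4_general {O H M Δ Γ : Type u} [CommRing O] [CommRing H] [HopfAlgebra O H]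
    [AddCommGroup M] [Group Δ] [Finite Δ] [DistribMulAction Δ M] [Group Γ]
    (G : SplitGeneralisedTorus O M Δ H) (hG : G.IsConjugationAction)
    (π : Γ →* Δ) (s : CosetReps π) (ρ₀ : G.Rep π O) :
    ∃ (b : z1Functor π M O ≅ G.repFunctor π) (h : h1Functor π M O ≅ G.orbitFunctor π)
      (c : (G.repFunctor π).CorepresentableBy (grpAlg O (s.Coinv M)))
      (φ : HomologyOne π M →+ s.Coinv M)
      (q : G.orbitFunctor π ⟶ coyoneda.obj (Opposite.op (grpAlg O (HomologyOne π M))))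
      (d : (G.pcFunctor π).CorepresentableBy (grpAlg O (HomologyOne π M))),
      (∀ (A : CommAlgCat.{u} O) (Φ : Z1 π M A) (γ : Γ),
        (G.ofCocycle b.hom A Φ).1 γ = G.ι A (Φ.1 γ) * Pt.map H (Algebra.ofId O A) (ρ₀.1 γ)) ∧
      (∀ (A : CommAlgCat.{u} O) (t : TorusPt M A) (Φ : Z1 π M A),
        G.ofCocycle b.hom A (coboundary π t * Φ) = t • G.ofCocycle b.hom A Φ) ∧
      (∀ (A : CommAlgCat.{u} O) (Φ : Z1 π M A),
        h.hom.app A (QuotientGroup.mk Φ : H1 π M A) = G.orbit A (G.ofCocycle b.hom A Φ)) ∧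
      (∀ (A : CommAlgCat.{u} O) (ψ : grpAlg O (s.Coinv M) ⟶ A),
        ∃ Φ : Z1 π M A,
          (∀ (γ : Γ) (m : M), ((Φ.1 γ).val m : A) =
            ψ.hom (single (s.natCocycle γ m) 1)) ∧
          G.ofPoint c A ψ = G.ofCocycle b.hom A Φ) ∧
      (∀ z : (d₁ π M).ker, φ (QuotientAddGroup.mk z) = z.1.sum fun γ m => s.natCocycle γ m) ∧
      (∀ (A : CommAlgCat.{u} O) (Φ : Z1 π M A) (z : (d₁ π M).ker),
        G.quotientPoint q A (G.ofCocycle b.hom A Φ)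
            (single (QuotientAddGroup.mk z) 1) =
          ((z.1.prod fun γ m => (Φ.1 γ).val m : Aˣ) : A)) ∧
      IsFpqcSheafification q ∧
      Function.Injective (mapDomainAlgHom O O φ) ∧
      (mapDomainAlgHom O O φ).range = G.repInvariants π c ∧
      (∀ (A : CommAlgCat.{u} O) (ψ : grpAlg O (s.Coinv M) ⟶ A),
        d.homEquiv (CommAlgCat.ofHom (mapDomainAlgHom O O φ) ≫ ψ) =
          PC.ofRep G (G.ofPoint c A ψ)) :=
  ⟨twistIso hG ρ₀, orbitIso hG ρ₀, repCorepresentableBy hG ρ₀ s, s.homologyHom M,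
    quotientMap hG ρ₀ s, pcCorepresentableBy hG ρ₀ s, fun _ _ _ => rfl,
    fun _ => twistEquiv_coboundary_mul hG ρ₀, fun _ _ => rfl,
    fun _ ψ => ⟨s.cocycleEquiv ((TorusPt.charEquiv O).symm ψ.hom), fun _ _ => rfl, rfl⟩,
    fun _ => rfl, quotientPoint_quotientMap_twistEquiv hG ρ₀ s,
    isFpqcSheafification_quotientMap hG ρ₀ s, mapDomain_injective s.homologyHom_injective,
    range_mapDomain_homologyHom hG ρ₀ s, pcCorepresentableBy_homEquiv_comp hG ρ₀ s⟩

theorem mainTheorem4 {O H M Δ Γ : Type u} [CommRing O] [ConnectedSpace (PrimeSpectrum O)]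
    [CommRing H] [HopfAlgebra O H] [AddCommGroup M] [Group Δ] [Finite Δ] [DistribMulAction Δ M]
    [Group Γ] (G : GenTorus.SplitGeneralisedTorus O M Δ H) (hG : G.IsConjugationAction)
    (π : Γ →* Δ) (hπ : Function.Surjective π) (s : GenTorus.CosetReps π) (ρ₀ : G.Rep π O) :
    ∃ (b : GenTorus.z1Functor π M O ≅ G.repFunctor π)
      (h : GenTorus.h1Functor π M O ≅ G.orbitFunctor π)
      (c : (G.repFunctor π).CorepresentableBy (GenTorus.grpAlg O (s.Coinv M)))
      (φ : GenTorus.HomologyOne π M →+ s.Coinv M)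
      (q : G.orbitFunctor π ⟶
        coyoneda.obj (Opposite.op (GenTorus.grpAlg O (GenTorus.HomologyOne π M))))
      (d : (G.pcFunctor π).CorepresentableBy (GenTorus.grpAlg O (GenTorus.HomologyOne π M))),
      -- `b` is the natural bijection `Φ ↦ Φ ρ₀`
      (∀ (A : CommAlgCat.{u} O) (Φ : GenTorus.Z1 π M A) (γ : Γ),
        (G.ofCocycle b.hom A Φ).1 γ =
          G.ι A (Φ.1 γ) * GenTorus.Pt.map H (Algebra.ofId O A) (ρ₀.1 γ)) ∧
      -- `b` is equivariant for `𝔇(M)(A)`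
      (∀ (A : CommAlgCat.{u} O) (t : GenTorus.TorusPt M A) (Φ : GenTorus.Z1 π M A),
        G.ofCocycle b.hom A (GenTorus.coboundary π t * Φ) = t • G.ofCocycle b.hom A Φ) ∧
      -- `h` is the induced bijection between `H¹` and the set of orbits
      (∀ (A : CommAlgCat.{u} O) (Φ : GenTorus.Z1 π M A),
        h.hom.app A (QuotientGroup.mk Φ : GenTorus.H1 π M A) =
          G.orbit A (G.ofCocycle b.hom A Φ)) ∧
      -- `Rep` is represented by `O[(ℰ ⊗ M)_Δ]`, via `b` and the universal cocycle
      (∀ (A : CommAlgCat.{u} O) (ψ : GenTorus.grpAlg O (s.Coinv M) ⟶ A),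
        ∃ Φ : GenTorus.Z1 π M A,
          (∀ (γ : Γ) (m : M), ((Φ.1 γ).val m : A) =
            ψ.hom (AddMonoidAlgebra.single (s.natCocycle γ m) 1)) ∧
          G.ofPoint c A ψ = G.ofCocycle b.hom A Φ) ∧
      -- `φ` is the homomorphism `φ_nat : H₁(Γ, M) → (ℰ ⊗ M)_Δ`
      (∀ z : (GenTorus.d₁ π M).ker,
        φ (QuotientAddGroup.mk z) = z.1.sum fun γ m => s.natCocycle γ m) ∧
      -- `q` is given by the pairing of cocycles with cycles, and it makes `Spec O[H₁(Γ, M)]` the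
      -- fpqc quotient of `Rep` by `𝔇(M)`
      (∀ (A : CommAlgCat.{u} O) (Φ : GenTorus.Z1 π M A) (z : (GenTorus.d₁ π M).ker),
        G.quotientPoint q A (G.ofCocycle b.hom A Φ)
            (AddMonoidAlgebra.single (QuotientAddGroup.mk z) 1) =
          ((z.1.prod fun γ m => (Φ.1 γ).val m : Aˣ) : A)) ∧
      GenTorus.IsFpqcSheafification q ∧
      -- it is a GIT quotient: `φ_nat` identifies `O[H₁(Γ, M)]` with the algebra of invariants
      Function.Injective (AddMonoidAlgebra.mapDomainAlgHom O O φ) ∧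
      (AddMonoidAlgebra.mapDomainAlgHom O O φ).range = G.repInvariants π c ∧
      -- `PC` is represented by `O[H₁(Γ, M)]`, compatibly with the map `ρ ↦ Θ_ρ` from `Rep`
      (∀ (A : CommAlgCat.{u} O) (ψ : GenTorus.grpAlg O (s.Coinv M) ⟶ A),
        d.homEquiv (CommAlgCat.ofHom (AddMonoidAlgebra.mapDomainAlgHom O O φ) ≫ ψ) =
          GenTorus.SplitGeneralisedTorus.PC.ofRep G (G.ofPoint c A ψ)) :=
  mainTheorem4_general G hG π s ρ₀
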